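/- **Setting.** Let $M>0$, $D(r)=1-\frac{2M}{r}$, and consider the Schwarzschild metric $g=-D\,dv^2+2\,dv\,dr+r^2(d\theta^2+\sin^2\theta\,d\alpha^2)$ on $\mathbb R_v\times[2M,\infty)_r\times\mathbb S^2$. Spherically symmetric functions are regarded as functions of $(v,r)$. Put $T=\partial_v$, $L=\frac D2\partial_r+\partial_v$, $\underline L=-\frac D2\partial_r$ in $(v,r)$-coordinates. Let $2M<r_{\mathcal H}<4M<R$, $v_0\in\mathbb R$, and let $\Sigma_0=\{v=v_{\Sigma_0}(r)\}$, $v_{\Sigma_0}(r)=v_0+\int_{2M}^r h$, where $h\ge 0$ is piecewise smooth with $h=0$ for $2M\le r\le r_{\mathcal H}$, $0<h<\frac 2D$ for $r_{\mathcal H}<r<R$, and $h=\frac2D$ for $r\ge R$. Thus $N_0^{\mathcal H}=\Sigma_0\cap\{r\le r_{\mathcal H}\}$ is ingoing null, $\Sigma_0^*=\Sigma_0\cap\{r_{\mathcal H}\le r\le R\}$ is spacelike in its interior, and $N_0^{\mathcal I}=\Sigma_0\cap\{r\ge R\}$ is outgoing null, of the form $\{u=u_0\}$ with $du=dv-2D^{-1}dr$.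 On $N_0^{\mathcal I}$, $\partial_r$ denotes the derivative in $(u,r)$-coordinates, that is, along $N_0^{\mathcal I}$. Write $$J^+(\Sigma_0)=\{(v,r): r\ge 2M,\ v\ge v_{\Sigma_0}(r)\}.$$ Let $\phi$ be a spherically symmetric solution of $\Box_g\phi=0$, smooth on $J^+(\Sigma_0)$ up to and including $\Sigma_0$ and the horizon. A *time integral* of $\phi$ is a spherically symmetric function $\phi^{(1)}$ on $J^+(\Sigma_0)$ (continuous, and $C^2$ for $r>2M$) with $$T\phi^{(1)}=\phi,\qquad \Box_g\phi^{(1)}=0,\qquad \lim_{v\to\infty}\phi^{(1)}(u_0,v)=0,\qquad \lim_{u\to\infty}\underline L\phi^{(1)}(u,v_0)=0 .$$ For a function $\psi$ as above define, whenever the limits along $N_0^{\mathcal I}$ exist, $$I_0^{\frac{\log r}{r^3}}[\psi]=\lim_{r\to\infty}\tfrac{r^3}{\log r}\partial_r(r\psi),\qquad I_0^{\log}[\psi]=\lim_{r\to\infty}\tfrac{r^2}{\log r}\partial_r(r\psi),$$ $$I_0'[\psi]=\lim_{r\to\infty}r^2\Big(\partial_r(r\psi)-I_0^{\log}[\psi]\tfrac{\log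 r+\log 2}{r^2}\Big),\qquad I_0''[\psi]=\lim_{r\to\infty}r^2\Big(\partial_r(r\psi)-I_0^{\log}[\psi]\tfrac{\log r-\log 2}{r^2}\Big).$$ Finally, with $n_{\Sigma_0}$ and $d\mu_{\Sigma_0}$ the future unit normal and the induced volume form of $\Sigma_0^*$, define $C_0[\phi]$ by $$C_0[\phi]=2\int_{N_0^{\mathcal H}}r\underline L(r\phi)\,du+\frac1{4\pi}\int_{\Sigma_0^*}n_{\Sigma_0}(\phi)\,d\mu_{\Sigma_0}+r^2\phi|_{\Sigma_0\cap\{r=r_{\mathcal H}\}}+r^2\phi|_{\Sigma_0\cap\{r=R\}}+2\int_{N_0^{\mathcal I}}rL(r\phi)\,dv .$$ **Proposition.** Let $R>0$ and $\beta\in(0,1)$. There is a constant $C=C(R,\beta)>0$ such that the following holds for all $M$, $\Sigma_0$ (with this $R$), and $\phi$ as above. Suppose that $I:=I_0^{\frac{\log r}{r^3}}[\phi]$ exists and that for some constants $J$, $P$ and all $r\ge R$, on $N_0^{\mathcal I}$, $$\Big|\partial_r(r\phi)-I\,\frac{\log r}{r^3}-\frac{J}{r^3}\Big|\le P\,r^{-3-\beta}.$$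 Put $K=C\,(P+|I|+|J|+|C_0[\phi]|)$. Then the time integral $\phi^{(1)}$ of $\phi$ satisfies on $N_0^{\mathcal I}$, for all $r\ge R$, $$\Big|\partial_r(r\phi^{(1)})+I\,\frac{\log r}{r^2}+\frac{J+\frac12 I-MC_0[\phi]}{r^2}\Big|\le K\,r^{-2-\beta},$$ $$\Big|\partial_r^2(r\phi^{(1)})-2I\,\frac{\log r}{r^3}-\frac{2J-2MC_0[\phi]}{r^3}\Big|\le K\,r^{-3-\beta}.$$ In particular, $I_0^{\log}[\phi^{(1)}]$, $I_0'[\phi^{(1)}]$ and $I_0''[\phi^{(1)}]$ exist, and $$I_0^{\log}[\phi^{(1)}]=-I_0^{\frac{\log r}{r^3}}[\phi],$$ $$I_0'[\phi^{(1)}]+\log 2\; I_0^{\log}[\phi^{(1)}]=MC_0[\phi]-J-\tfrac12 I_0^{\frac{\log r}{r^3}}[\phi],$$ $$I_0''[\phi^{(1)}]-\log 2\; I_0^{\log}[\phi^{(1)}]=MC_0[\phi]-J-\tfrac12 I_0^{\frac{\log r}{r^3}}[\phi].$$ -/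

import Mathlib

open scoped ContDiff
open Set Filter Topology

namespace Schwarzschild

/-- The metric function `D(r) = 1 - 2M/r`. -/
noncomputable def D (M r : ℝ) : ℝ := 1 - 2 * M / r

/-- The components of the Schwarzschild metric
`-D dv² + 2 dv dr + r² (dθ² + sin² θ dα²)` in the coordinates `(x 0, x 1, x 2, x 3) = (v, r, θ, α)`. -/
noncomputable def metric (M : ℝ) (x : Fin 4 → ℝ) : Matrix (Fin 4) (Fin 4) ℝ :=
  !![-(D M (x 1)), 1, 0, 0;
     1, 0, 0, 0;
     0, 0, (x 1) ^ 2, 0;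
     0, 0, 0, (x 1) ^ 2 * Real.sin (x 2) ^ 2]

/-- The `i`-th partial derivative of a function on coordinate space. -/
noncomputable def pd (i : Fin 4) (f : (Fin 4 → ℝ) → ℝ) (x : Fin 4 → ℝ) : ℝ :=
  deriv (fun s => f (Function.update x i s)) (x i)

/-- The Laplace–Beltrami (wave) operator
`|det g|^{-1/2} ∑ ∂_i (|det g|^{1/2} g^{ij} ∂_j f)` of a metric given by its components `g`. -/
noncomputable def box (g : (Fin 4 → ℝ) → Matrix (Fin 4) (Fin 4) ℝ) (f : (Fin 4 → ℝ) → ℝ)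
    (x : Fin 4 → ℝ) : ℝ :=
  (√|(g x).det|)⁻¹ *
    ∑ i, pd i (fun y => √|(g y).det| * ∑ j, (g y)⁻¹ i j * pd j f y) x

/-- A spherically symmetric function, given as a function of `(v, r)`,
regarded as a function of `(v, r, θ, α)`. -/
def lift (φ : ℝ × ℝ → ℝ) (x : Fin 4 → ℝ) : ℝ := φ (x 0, x 1)

/-- `h` is smooth on each piece, up to the ends of the piece, of a finite partition of `[a, b]`. -/
def PiecewiseSmooth (h : ℝ → ℝ) (a b : ℝ) : Prop :=
  ∃ (n : ℕ) (t : ℕ → ℝ), t 0 = a ∧ t n = b ∧ ∀ i < n, t i < t (i + 1) ∧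
    ∃ g : ℝ → ℝ, ContDiffOn ℝ ∞ g (Icc (t i) (t (i + 1))) ∧ EqOn h g (Ioo (t i) (t (i + 1)))

/-- A spherically symmetric hypersurface `Σ₀ = {v = v₀ + ∫_{2M}^r h}` which is ingoing null for
`2M ≤ r ≤ r_H`, strictly spacelike for `r_H < r < R`, and outgoing null for `r ≥ R`. -/
structure Slice (M R : ℝ) where
  rH : ℝ
  v₀ : ℝ
  h : ℝ → ℝ
  two_mul_lt_rH : 2 * M < rH
  rH_lt : rH < 4 * M
  lt_R : 4 * M < R
  h_horizon : ∀ r ∈ Icc (2 * M) rH, h r = 0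
  h_spacelike : ∀ r ∈ Ioo rH R, 0 < h r ∧ h r < 2 / D M r
  h_infinity : ∀ r, R ≤ r → h r = 2 / D M r
  h_smooth : PiecewiseSmooth h rH R

namespace Slice

variable {M R : ℝ}

/-- The height function `v_{Σ₀}(r)`. -/
noncomputable def height (S : Slice M R) (r : ℝ) : ℝ := S.v₀ + ∫ s in (2 * M)..r, S.h s

/-- The point of `Σ₀` of area radius `r`, in `(v, r)`-coordinates. -/
noncomputable def pt (S : Slice M R) (r : ℝ) : ℝ × ℝ := (S.height r, r)

/-- The causal future `J⁺(Σ₀)`, in `(v, r)`-coordinates, including `Σ₀` and the future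
event horizon `r = 2M`. -/
def future (S : Slice M R) : Set (ℝ × ℝ) := {p | 2 * M ≤ p.2 ∧ S.height p.2 ≤ p.1}

/-- `∂_v` in `(v, r)`-coordinates, that is, the Killing field `T` (one-sided on the boundary
of `J⁺(Σ₀)`). -/
noncomputable def dv (S : Slice M R) (f : ℝ × ℝ → ℝ) (p : ℝ × ℝ) : ℝ :=
  fderivWithin ℝ f S.future p (1, 0)

/-- `∂_r` in `(v, r)`-coordinates (one-sided on the boundary of `J⁺(Σ₀)`). -/
noncomputable def dr (S : Slice M R) (f : ℝ × ℝ → ℝ) (p : ℝ × ℝ) : ℝ :=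
  fderivWithin ℝ f S.future p (0, 1)

/-- The outgoing null vector field `L = (D/2) ∂_r + ∂_v`. -/
noncomputable def L (S : Slice M R) (f : ℝ × ℝ → ℝ) (p : ℝ × ℝ) : ℝ :=
  D M p.2 / 2 * S.dr f p + S.dv f p

/-- The ingoing null vector field `L̲ = -(D/2) ∂_r`. -/
noncomputable def Lbar (S : Slice M R) (f : ℝ × ℝ → ℝ) (p : ℝ × ℝ) : ℝ :=
  -(D M p.2 / 2) * S.dr f p

/-- The future unit normal of the spacelike part of `Σ₀`, applied to `f` at radius `r`. -/
noncomputable def normal (S : Slice M R) (f : ℝ × ℝ → ℝ) (r : ℝ) : ℝ :=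
  (S.h r * S.dv f (S.pt r) - (1 - D M r * S.h r) * S.dr f (S.pt r)) /
    √(S.h r * (2 - D M r * S.h r))

/-- The density of the induced volume form of the spacelike part of `Σ₀` with respect
to `dr dω`. -/
noncomputable def volDensity (S : Slice M R) (r : ℝ) : ℝ :=
  r ^ 2 * √(S.h r * (2 - D M r * S.h r))

/-- `□_g f = 0` in the interior of `J⁺(Σ₀)`. -/
def SolvesWave (S : Slice M R) (f : ℝ × ℝ → ℝ) : Prop :=
  ∀ v r θ α : ℝ, 2 * M < r → S.height r < v → θ ∈ Ioo 0 Real.pi →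
    box (metric M) (lift f) ![v, r, θ, α] = 0

/-- `φ` is a spherically symmetric solution of the wave equation on `J⁺(Σ₀)`, smooth up to and
including `Σ₀` and the event horizon. -/
structure IsSmoothSolution (S : Slice M R) (φ : ℝ × ℝ → ℝ) : Prop where
  smooth : ContDiffOn ℝ ∞ φ S.future
  wave : S.SolvesWave φ

/-- `φ₁` is the time integral of `φ`. Away from the event horizon only two derivatives are
required; at the horizon `φ₁` is only assumed to be continuous, and the condition
`lim_{u → ∞} L̲ φ₁ (u, v₀) = 0` is imposed. -/
structure IsTimeIntegral (S : Slice M R) (φ φ₁ : ℝ × ℝ → ℝ) : Prop where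
  cont : ContinuousOn φ₁ S.future
  regular : ContDiffOn ℝ 2 φ₁ (S.future ∩ {p | 2 * M < p.2})
  time_deriv : ∀ p ∈ S.future, 2 * M < p.2 → S.dv φ₁ p = φ p
  wave : S.SolvesWave φ₁
  lim_infinity : Tendsto (fun r => φ₁ (S.pt r)) atTop (𝓝 0)
  lim_horizon : Tendsto (fun r => S.Lbar φ₁ (S.v₀, r)) (𝓝[>] (2 * M)) (𝓝 0)

/-- The function `r ↦ ∂_r (r φ)` along the outgoing null part `r ≥ R` of `Σ₀`, with `∂_r` taken
in `(u, r)`-coordinates, hence tangent to it. -/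
noncomputable def drad (S : Slice M R) (φ : ℝ × ℝ → ℝ) (r : ℝ) : ℝ :=
  derivWithin (fun s => s * φ (S.pt s)) (Ici R) r

/-- The function `r ↦ ∂_r² (r φ)` along the outgoing null part `r ≥ R` of `Σ₀`. -/
noncomputable def drad2 (S : Slice M R) (φ : ℝ × ℝ → ℝ) (r : ℝ) : ℝ :=
  derivWithin (S.drad φ) (Ici R) r

/-- `c` is the modified Newman–Penrose constant of `φ` with weight `f`, the limit of
`f(r) ∂_r (r φ)` at future null infinity along `Σ₀`. -/
def IsNPConstant (S : Slice M R) (f : ℝ → ℝ) (φ : ℝ × ℝ → ℝ) (c : ℝ) : Prop :=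
  Tendsto (fun r => f r * S.drad φ r) atTop (𝓝 c)

/-- `c = lim r² (∂_r (r φ) - a (log r + s) / r²)` at future null infinity along `Σ₀`. -/
def IsPrimedConstant (S : Slice M R) (φ : ℝ × ℝ → ℝ) (a s c : ℝ) : Prop :=
  Tendsto (fun r => r ^ 2 * (S.drad φ r - a * (Real.log r + s) / r ^ 2)) atTop (𝓝 c)

/-- The function `r φ`. -/
def rmul (φ : ℝ × ℝ → ℝ) (p : ℝ × ℝ) : ℝ := p.2 * φ p

/-- The constant `C₀'[φ]`. The area `4π` of the unit sphere is divided out. On the ingoing null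
part `|du| = 2 D⁻¹ dr`. -/
noncomputable def C₀' (S : Slice M R) (φ : ℝ × ℝ → ℝ) : ℝ :=
  2 * (∫ r in (2 * M)..S.rH, r * S.Lbar (rmul φ) (S.pt r) * (2 / D M r))
    + (∫ r in S.rH..R, S.normal φ r * S.volDensity r)
    + (S.rH ^ 2 * φ (S.pt S.rH) + R ^ 2 * φ (S.pt R))

/-- The constant `C₀[φ]`, which adds to `C₀'[φ]` the integral over the outgoing null part of `Σ₀`,
where `dv = 2 D⁻¹ dr`. -/
noncomputable def C₀ (S : Slice M R) (φ : ℝ × ℝ → ℝ) : ℝ :=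
  S.C₀' φ + 2 * ∫ r in Ioi R, r * S.L (rmul φ) (S.pt r) * (2 / D M r)

end Slice

end Schwarzschild

/-! ### Decay estimates on a half-line -/

namespace Schwarzschild

/-! For spherically symmetric functions the wave equation is a conservation law in `(v, r)`. Once
`∂_v φ₁ = φ` is inserted, it becomes a first-order equation in `r` for the flux `r² D ∂_r φ₁`, with
a source built from `φ` alone. Restricted to `Σ₀`, the flux can therefore be integrated outwards
from the horizon, where the condition on `L̲ φ₁` makes it vanish.

On each piece of `Σ₀` the result is the matching part of `C₀`. The ingoing piece gives its null
integral (`flux_rH`). On the spacelike piece the derivative of `flux + r² φ` is exactly the normal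
derivative times the volume density, which produces the two sphere terms (`flux_R`). On the outgoing
piece `G = flux + 2 r² φ` equals `D r²` times the tangential derivative of `φ₁` and satisfies `G' =
2 r ∂_r(rφ)`. Hence `G` tends to `C₀` (`tendsto_nullFlux`).

The rest is a problem in one variable. Integrating `G'` inwards from infinity expands `G` about `C₀`
(`flux_remainder`). Dividing by `D r²` and integrating again from infinity, where `φ₁` vanishes,
expands `φ₁` and hence `∂_r(rφ₁)` (`first_derivative_expansion`). The factor `M` in `M C₀` comes
from `1/D = 1 + 2M/r + O(r⁻²)`. The second derivative is an algebraic expression in `∂_r(rφ)` and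
`G` (`drad2_eq`), so no error term is ever differentiated. Uniformity in `M` follows from `4M < R`.
-/

theorem abs_le_of_deriv_decay {F F' : ℝ → ℝ} {R K a : ℝ} (hR : 0 < R) (ha : 0 < a)
    (hF : ∀ r, R ≤ r → HasDerivWithinAt F (F' r) (Ici R) r)
    (hF' : ∀ r, R ≤ r → |F' r| ≤ K * r ^ (-a - 1)) (hlim : Tendsto F atTop (𝓝 0)) :
    ∀ r, R ≤ r → |F r| ≤ K / a * r ^ (-a) := by
  have hp : ∀ r, R ≤ r → HasDerivWithinAt (fun r : ℝ => K / a * r ^ (-a))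
      (-(K * r ^ (-a - 1))) (Ici R) r := by
    intro r hr
    have h := ((Real.hasDerivAt_rpow_const (x := r) (p := -a)
      (Or.inl (hR.trans_le hr).ne')).const_mul (K / a)).hasDerivWithinAt (s := Ici R)
    exact h.congr_deriv (by field_simp)
  have hlimp : Tendsto (fun r : ℝ => K / a * r ^ (-a)) atTop (𝓝 0) := by
    simpa using (tendsto_rpow_neg_atTop ha).const_mul (K / a)
  have hint : ∀ x ∈ interior (Ici R), R ≤ x := fun x hx => interior_subset hx
  -- The two functions `F ± (K/a) r^(-a)` are monotone and tend to zero, so each has a fixed sign.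
  -- This replaces integrating `F'` from infinity and needs no integrability of `F'`.
  have h1 : AntitoneOn (fun r => F r + K / a * r ^ (-a)) (Ici R) := by
    refine antitoneOn_of_hasDerivWithinAt_nonpos (f' := fun r => F' r + -(K * r ^ (-a - 1)))
      (convex_Ici R)
      (fun x hx => ((hF x hx).add (hp x hx)).continuousWithinAt)
      (fun x hx => ((hF x (hint x hx)).add (hp x (hint x hx))).mono interior_subset) ?_
    intro x hx
    have := (abs_le.1 (hF' x (hint x hx))).2
    linarith
  have h2 : MonotoneOn (fun r => F r - K / a * r ^ (-a)) (Ici R) := by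
    refine monotoneOn_of_hasDerivWithinAt_nonneg (f' := fun r => F' r - -(K * r ^ (-a - 1)))
      (convex_Ici R)
      (fun x hx => ((hF x hx).sub (hp x hx)).continuousWithinAt)
      (fun x hx => ((hF x (hint x hx)).sub (hp x (hint x hx))).mono interior_subset) ?_
    intro x hx
    have := (abs_le.1 (hF' x (hint x hx))).1
    linarith
  intro r hr
  have l1 : 0 ≤ F r + K / a * r ^ (-a) := by
    refine le_of_tendsto (by simpa using hlim.add hlimp) ?_
    filter_upwards [eventually_ge_atTop r] with s hs
    exact h1 hr (hr.trans hs) hs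
  have l2 : F r - K / a * r ^ (-a) ≤ 0 := by
    refine ge_of_tendsto (by simpa using hlim.sub hlimp) ?_
    filter_upwards [eventually_ge_atTop r] with s hs
    exact h2 hr (hr.trans hs) hs
  rw [abs_le]
  constructor <;> linarith

/-- This trades a logarithm for a power: an error of size `r⁻² log r` becomes one of size
`r^(-1-β)`, with a factor depending only on `R` and `β`. The growth comes from `log (r/R) ≤
(r/R)^(1-β)/(1-β)`, and since `(r/R)^(1-β) ≥ 1` the constants `|log R| + 1` are absorbed as well. -/
theorem exists_log_bound {R β : ℝ} (hR : 0 < R) (hβ1 : β < 1) :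
    ∃ Λ : ℝ, 0 < Λ ∧ ∀ r, R ≤ r → |Real.log r| + 1 ≤ Λ * r ^ (1 - β) := by
  refine ⟨(|Real.log R| + 1 / (1 - β) + 1) * R ^ (-(1 - β)), ?_, ?_⟩
  · have : 0 < 1 - β := by linarith
    positivity
  intro r hr
  have hb : 0 < 1 - β := by linarith
  have hr0 := hR.trans_le hr
  have hx : 1 ≤ r / R := (one_le_div hR).2 hr
  have h1 : 1 ≤ (r / R) ^ (1 - β) := Real.one_le_rpow hx hb.le
  have h2 : Real.log (r / R) ≤ (r / R) ^ (1 - β) / (1 - β) :=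
    Real.log_le_rpow_div (by positivity) hb
  have h3 : Real.log r = Real.log R + Real.log (r / R) := by
    rw [Real.log_div hr0.ne' hR.ne']; ring
  have h4 : 0 ≤ Real.log (r / R) := Real.log_nonneg hx
  have h5 : |Real.log r| ≤ |Real.log R| + Real.log (r / R) := by
    rw [h3]; exact (abs_add_le _ _).trans (by rw [abs_of_nonneg h4])
  have h6 : (|Real.log R| + 1 / (1 - β) + 1) * R ^ (-(1 - β)) * r ^ (1 - β)
      = (|Real.log R| + 1) * (r / R) ^ (1 - β) + (r / R) ^ (1 - β) / (1 - β) := by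
    rw [Real.div_rpow hr0.le hR.le, Real.rpow_neg hR.le]; field_simp; ring
  rw [h6]
  nlinarith [abs_nonneg (Real.log R)]

theorem tendsto_log_add_const_div (c : ℝ) :
    Tendsto (fun r : ℝ => (Real.log r + c) / r) atTop (𝓝 0) := by
  have h1 : Tendsto (fun r : ℝ => Real.log r / r) atTop (𝓝 0) :=
    Real.isLittleO_log_id_atTop.tendsto_div_nhds_zero
  have h2 : Tendsto (fun r : ℝ => c / r) atTop (𝓝 0) := tendsto_const_nhds.div_atTop tendsto_id
  simpa [add_div] using h1.add h2

/-! ### Asymptotic integration of the flux equation -/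

section Asymptotics

variable {R M β Λ I J P c : ℝ} {q G : ℝ → ℝ}

/-- Since `(log r + 1)/r` has derivative `-log r / r²`, the corrected `G` has derivative exactly
`2r` times the remainder of `q`. That derivative is `O(r^(-2-β))`, and the corrected `G` tends to
zero. -/
theorem flux_remainder (hR : 0 < R) (hβ0 : 0 < β) (hP : 0 ≤ P)
    (hq : ∀ r, R ≤ r → |q r - I * (Real.log r / r ^ 3) - J / r ^ 3| ≤ P * r ^ (-3 - β))
    (hG : ∀ r, R ≤ r → HasDerivWithinAt G (2 * r * q r) (Ici R) r)
    (hlim : Tendsto G atTop (𝓝 c)) :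
    ∀ r, R ≤ r → |G r - c + 2 * I * ((Real.log r + 1) / r) + 2 * J / r| ≤
      2 * P * r ^ (-1 - β) := by
  intro r hr
  have key := abs_le_of_deriv_decay (F := fun r => G r - c + 2 * I * ((Real.log r + 1) / r)
      + 2 * J / r) (F' := fun r => 2 * r * (q r - I * (Real.log r / r ^ 3) - J / r ^ 3))
      (K := 2 * P) (a := 1 + β) hR (by linarith) ?_ ?_ ?_ r hr
  · refine key.trans ?_
    rw [show -(1 + β) = -1 - β by ring]
    gcongr
    · exact Real.rpow_nonneg (hR.trans_le hr).le _
    · exact div_le_self (by linarith) (by linarith)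
  · intro r hr
    have hr0 := (hR.trans_le hr).ne'
    have hl : HasDerivAt (fun r : ℝ => 2 * I * ((Real.log r + 1) / r) + 2 * J / r)
        (2 * I * ((r⁻¹ * r - (Real.log r + 1) * 1) / r ^ 2) + (0 * r - 2 * J * 1) / r ^ 2) r :=
      ((((Real.hasDerivAt_log hr0).add_const 1).div (hasDerivAt_id r) hr0).const_mul (2 * I)).add
        ((hasDerivAt_const r (2 * J)).div (hasDerivAt_id r) hr0)
    have := ((hG r hr).sub_const c).add (hl.hasDerivWithinAt (s := Ici R))
    refine (this.congr_deriv ?_).congr_of_mem (fun x _ => ?_) hr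
    · field_simp; ring
    · simp [add_assoc]
  · intro r hr
    have hr0 := hR.trans_le hr
    rw [abs_mul, abs_of_pos (by positivity : 0 < 2 * r)]
    have h1 : r ^ (-(1 + β) - 1) = r * r ^ (-3 - β) := by
      rw [← Real.rpow_one_add' hr0.le (by linarith)]; ring_nf
    rw [h1]
    nlinarith [hq r hr, mul_le_mul_of_nonneg_left (hq r hr) (by positivity : 0 ≤ 2 * r)]
  · have h1 := ((hlim.sub_const c).add ((tendsto_log_add_const_div 1).const_mul (2 * I))).add
      ((tendsto_const_nhds (x := 2 * J)).div_atTop tendsto_id)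
    simpa using h1

/-- Elementary bounds on `1 / D` for `r ≥ R > 4M`. -/
theorem inv_D_bounds {r : ℝ} (hM : 0 < M) (hMR : 4 * M < R) (hr : R ≤ r) :
    0 < (D M r)⁻¹ ∧ (D M r)⁻¹ ≤ 2 ∧ |(D M r)⁻¹ - 1| ≤ R / r ∧
      |(D M r)⁻¹ - 1 - 2 * M / r| ≤ R ^ 2 / r ^ 2 := by
  have hr0 : 0 < r := by linarith
  have hD : D M r = (r - 2 * M) / r := by unfold D; field_simp
  have hs : 0 < r - 2 * M := by linarith
  have e1 : (D M r)⁻¹ - 1 = 2 * M / (r - 2 * M) := by rw [hD]; field_simp; ring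
  have e2 : (D M r)⁻¹ - 1 - 2 * M / r = 4 * M ^ 2 / (r * (r - 2 * M)) := by
    rw [e1]; field_simp; ring
  refine ⟨?_, ?_, ?_, ?_⟩
  · rw [hD]; positivity
  · rw [hD, inv_div, div_le_iff₀ hs]; linarith
  · rw [e1, abs_of_pos (by positivity), div_le_div_iff₀ hs hr0]; nlinarith
  · rw [e2, abs_of_pos (by positivity), div_le_div_iff₀ (by positivity) (by positivity)]
    have : 8 * M ^ 2 ≤ R ^ 2 := by nlinarith
    have h2 : r ≤ 2 * (r - 2 * M) := by linarith
    nlinarith [mul_le_mul_of_nonneg_left h2 (by positivity : 0 ≤ 4 * M ^ 2 * r),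
      mul_le_mul_of_nonneg_right this (by positivity : 0 ≤ r * (r - 2 * M))]

/-- The remainder in the expansion of `r ^ 2 ∂_r f`, where `D r ^ 2 ∂_r f = G`. -/
theorem gradient_remainder (hM : 0 < M) (hMR : 4 * M < R)
    (hP : 0 ≤ P) (hΛ : ∀ r, R ≤ r → |Real.log r| + 1 ≤ Λ * r ^ (1 - β))
    (hE : ∀ r, R ≤ r → |G r - c + 2 * I * ((Real.log r + 1) / r) + 2 * J / r| ≤
      2 * P * r ^ (-1 - β)) {r : ℝ} (hr : R ≤ r) :
    |(D M r)⁻¹ * G r - (c + 2 * M * c / r - 2 * I * ((Real.log r + 1) / r) - 2 * J / r)| ≤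
      (R ^ 2 * Λ + 2 * R * Λ + 4) * (P + |I| + |J| + |c|) * r ^ (-1 - β) := by
  obtain ⟨d0, d2, d3, d4⟩ := inv_D_bounds hM hMR hr
  have hR : 0 < R := by linarith
  have hr0 : 0 < r := hR.trans_le hr
  have hE := hE r hr
  have hl := hΛ r hr
  set d := (D M r)⁻¹
  set l := Real.log r
  set X := r ^ (-1 - β) with hX
  set E := G r - c + 2 * I * ((l + 1) / r) + 2 * J / r with hEdef
  have hX0 : 0 < X := Real.rpow_pos_of_pos hr0 _
  have hΛX : (|l| + 1) / r ^ 2 ≤ Λ * X := by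
    rw [div_le_iff₀ (by positivity)]
    have : X * r ^ 2 = r ^ (1 - β) := by
      rw [hX, ← Real.rpow_natCast r 2, ← Real.rpow_add hr0]; congr 1; push_cast; ring
    rw [mul_assoc, this]; exact hl
  have h1X : 1 / r ^ 2 ≤ Λ * X := le_trans (by gcongr; linarith [abs_nonneg l]) hΛX
  have hΛX0 : 0 ≤ Λ * X := le_trans (by positivity) h1X
  have hlX : |l + 1| / r ^ 2 ≤ Λ * X := le_trans (by
    gcongr; exact (abs_add_le _ _).trans (by simp)) hΛX
  -- With `d = 1/D`, every term but the last pairs an explicit coefficient with a power of the small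
  -- quantity `d - 1`, corrected by `2M/r` where the coefficient `c` does not decay. The last term
  -- carries the remainder of `G`.
  have e : d * G r - (c + 2 * M * c / r - 2 * I * ((l + 1) / r) - 2 * J / r) =
      c * (d - 1 - 2 * M / r) - (d - 1) * (2 * I * ((l + 1) / r)) - (d - 1) * (2 * J / r)
        + d * E := by
    rw [hEdef]; ring
  have t1 : |c * (d - 1 - 2 * M / r)| ≤ |c| * (R ^ 2 * (Λ * X)) := by
    rw [abs_mul]
    refine mul_le_mul_of_nonneg_left (d4.trans ?_) (abs_nonneg c)
    calc R ^ 2 / r ^ 2 = R ^ 2 * (1 / r ^ 2) := by ring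
      _ ≤ _ := by gcongr
  have t2 : |(d - 1) * (2 * I * ((l + 1) / r))| ≤ |I| * (2 * R * (Λ * X)) := by
    rw [abs_mul, abs_mul, abs_mul, abs_div, abs_two, abs_of_pos hr0]
    calc |d - 1| * (2 * |I| * (|l + 1| / r)) ≤ R / r * (2 * |I| * (|l + 1| / r)) := by gcongr
      _ = |I| * (2 * R * (|l + 1| / r ^ 2)) := by ring
      _ ≤ _ := by gcongr
  have t3 : |(d - 1) * (2 * J / r)| ≤ |J| * (2 * R * (Λ * X)) := by
    rw [abs_mul, abs_div, abs_mul, abs_two, abs_of_pos hr0]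
    calc |d - 1| * (2 * |J| / r) ≤ R / r * (2 * |J| / r) := by gcongr
      _ = |J| * (2 * R * (1 / r ^ 2)) := by ring
      _ ≤ _ := by gcongr
  have t4 : |d * E| ≤ 4 * P * X := by
    rw [abs_mul, abs_of_pos d0]
    calc d * |E| ≤ 2 * (2 * P * X) := by gcongr
      _ = _ := by ring
  rw [e]
  have tri := abs_add_le (c * (d - 1 - 2 * M / r) - (d - 1) * (2 * I * ((l + 1) / r))
    - (d - 1) * (2 * J / r)) (d * E)
  have tri2 := abs_sub (c * (d - 1 - 2 * M / r) - (d - 1) * (2 * I * ((l + 1) / r)))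
    ((d - 1) * (2 * J / r))
  have tri3 := abs_sub (c * (d - 1 - 2 * M / r)) ((d - 1) * (2 * I * ((l + 1) / r)))
  have f1 : |c| * (R ^ 2 * (Λ * X)) ≤ (P + |I| + |J| + |c|) * (R ^ 2 * (Λ * X)) := by
    gcongr; linarith [abs_nonneg I, abs_nonneg J]
  have f2 : (|I| + |J|) * (2 * R * (Λ * X)) ≤ (P + |I| + |J| + |c|) * (2 * R * (Λ * X)) :=
    mul_le_mul_of_nonneg_right (by linarith [abs_nonneg c]) (by positivity)
  have f3 : 4 * P * X ≤ (P + |I| + |J| + |c|) * (4 * X) := by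
    rw [mul_comm 4 P, mul_assoc]
    gcongr; linarith [abs_nonneg I, abs_nonneg J, abs_nonneg c]
  linarith

/-- Here `f` is `φ₁` along the null part and `f + r f'` is `∂_r(rφ₁)`. Integrating the expansion of
`f'` from infinity gives that of `f`; in the sum the `c/r` terms cancel, which leaves `r⁻²` as the
leading power. -/
theorem first_derivative_expansion {f : ℝ → ℝ} (hM : 0 < M) (hMR : 4 * M < R) (hβ0 : 0 < β)
    (hP : 0 ≤ P) (hΛ : ∀ r, R ≤ r → |Real.log r| + 1 ≤ Λ * r ^ (1 - β))
    (hE : ∀ r, R ≤ r → |G r - c + 2 * I * ((Real.log r + 1) / r) + 2 * J / r| ≤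
      2 * P * r ^ (-1 - β))
    (hf : ∀ r, R ≤ r → HasDerivWithinAt f ((D M r)⁻¹ * G r / r ^ 2) (Ici R) r)
    (hlim : Tendsto f atTop (𝓝 0)) {r : ℝ} (hr : R ≤ r) :
    |f r + r * ((D M r)⁻¹ * G r / r ^ 2) + I * (Real.log r / r ^ 2)
      + (J + 1 / 2 * I - M * c) / r ^ 2| ≤
      2 * (R ^ 2 * Λ + 2 * R * Λ + 4) * (P + |I| + |J| + |c|) * r ^ (-2 - β) := by
  have hR : 0 < R := by linarith
  set k := (R ^ 2 * Λ + 2 * R * Λ + 4) * (P + |I| + |J| + |c|) with hk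
  set e : ℝ → ℝ := fun r => (D M r)⁻¹ * G r -
    (c + 2 * M * c / r - 2 * I * ((Real.log r + 1) / r) - 2 * J / r) with he
  have hb : ∀ r, R ≤ r → |e r| ≤ k * r ^ (-1 - β) := fun r hr =>
    gradient_remainder hM hMR hP hΛ hE hr
  -- The antiderivative, vanishing at infinity, of the leading part of `f'` is subtracted. The
  -- coefficient `3/2` is `1` from the `+1` in `log r + 1` plus `1/2` from integrating `r⁻³ log r`.
  set F : ℝ → ℝ := fun r => f r + (c / r - (J - M * c + 3 / 2 * I) / r ^ 2
    - I * (Real.log r / r ^ 2)) with hF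
  -- No sign of `Λ` is assumed here, so the sign of `k` is read off from the bound at `r = R`.
  have hk0 : 0 ≤ k := by
    have := (abs_nonneg _).trans (hb R le_rfl)
    exact nonneg_of_mul_nonneg_left this (Real.rpow_pos_of_pos hR _)
  have hd : ∀ r, R ≤ r → HasDerivWithinAt F (e r / r ^ 2) (Ici R) r := by
    intro r hr
    have hr0 := (hR.trans_le hr).ne'
    have h2 : HasDerivAt (fun r : ℝ => r ^ 2) (2 * r) r := by simpa using hasDerivAt_pow 2 r
    have h3 := (((hasDerivAt_const r c).div (hasDerivAt_id r) hr0).sub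
      ((hasDerivAt_const r (J - M * c + 3 / 2 * I)).div h2 (pow_ne_zero 2 hr0))).sub
      (((Real.hasDerivAt_log hr0).div h2 (pow_ne_zero 2 hr0)).const_mul I)
    refine ((hf r hr).add (h3.hasDerivWithinAt (s := Ici R))).congr_deriv ?_
    simp only [he, id]
    field_simp
    ring
  have hFlim : Tendsto F atTop (𝓝 0) := by
    have h1 : Tendsto (fun r : ℝ => c / r) atTop (𝓝 0) :=
      tendsto_const_nhds.div_atTop tendsto_id
    have h2 : Tendsto (fun r : ℝ => (J - M * c + 3 / 2 * I) / r ^ 2) atTop (𝓝 0) :=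
      tendsto_const_nhds.div_atTop (tendsto_pow_atTop two_ne_zero)
    have h3 : Tendsto (fun r : ℝ => Real.log r / r ^ 2) atTop (𝓝 0) := by
      have := (tendsto_log_add_const_div 0).mul tendsto_inv_atTop_zero
      simp only [add_zero, mul_zero] at this
      refine this.congr fun x => ?_
      rw [div_mul_eq_mul_div, ← div_eq_mul_inv, div_div, sq]
    simpa using hlim.add ((h1.sub h2).sub (h3.const_mul I))
  have hFb := abs_le_of_deriv_decay (K := k) (a := 2 + β) hR (by linarith) hd (fun r hr => by
    have hr0 := hR.trans_le hr
    rw [abs_div, abs_of_pos (by positivity : 0 < r ^ 2), div_le_iff₀ (by positivity)]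
    refine (hb r hr).trans_eq ?_
    rw [mul_assoc k, ← Real.rpow_natCast r 2, ← Real.rpow_add hr0]
    congr 2; push_cast; ring) hFlim r hr
  have hr0 := hR.trans_le hr
  have hX : 0 < r ^ (-2 - β) := Real.rpow_pos_of_pos hr0 _
  have hFb' : |F r| ≤ k * r ^ (-2 - β) := by
    refine hFb.trans ?_
    rw [show -(2 + β) = -2 - β by ring]
    gcongr
    exact div_le_self hk0 (by linarith)
  have hEb : |e r / r| ≤ k * r ^ (-2 - β) := by
    rw [abs_div, abs_of_pos hr0, div_le_iff₀ hr0]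
    refine (hb r hr).trans_eq ?_
    rw [mul_assoc k, ← Real.rpow_add_one hr0.ne']
    congr 2; ring
  have heq : f r + r * ((D M r)⁻¹ * G r / r ^ 2) + I * (Real.log r / r ^ 2)
      + (J + 1 / 2 * I - M * c) / r ^ 2 = F r + e r / r := by
    simp only [hF, he]
    field_simp
    ring
  rw [heq]
  have := abs_add_le (F r) (e r / r)
  rw [mul_assoc 2, ← hk]
  linarith

/-- The bounded quantity is the exact formula for `∂_r²(rφ₁)` minus its leading terms. At leading
order `1/D` may be replaced by `1`, `q` by its expansion and `G` by `c`; each replacement costs one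
more power of `r`, up to a logarithm, or a remainder already controlled. -/
theorem second_derivative_expansion (hM : 0 < M) (hMR : 4 * M < R) (hP : 0 ≤ P)
    (hΛ : ∀ r, R ≤ r → |Real.log r| + 1 ≤ Λ * r ^ (1 - β))
    (hq : ∀ r, R ≤ r → |q r - I * (Real.log r / r ^ 3) - J / r ^ 3| ≤ P * r ^ (-3 - β))
    (hE : ∀ r, R ≤ r → |G r - c + 2 * I * ((Real.log r + 1) / r) + 2 * J / r| ≤
      2 * P * r ^ (-1 - β)) {r : ℝ} (hr : R ≤ r) :
    |2 * (D M r)⁻¹ * q r - 2 * M * (D M r)⁻¹ ^ 2 * G r / r ^ 3 - 2 * I * (Real.log r / r ^ 3)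
      - (2 * J - 2 * M * c) / r ^ 3| ≤
      (2 * R ^ 2 * Λ + 6 * R * Λ + 8) * (P + |I| + |J| + |c|) * r ^ (-3 - β) := by
  obtain ⟨d0, d2, d3, -⟩ := inv_D_bounds hM hMR hr
  have hR : 0 < R := by linarith
  have hr0 : 0 < r := hR.trans_le hr
  have hE := hE r hr
  have hq := hq r hr
  have hl := hΛ r hr
  set d := (D M r)⁻¹
  set l := Real.log r
  set Y := r ^ (-3 - β) with hY
  set E := G r - c + 2 * I * ((l + 1) / r) + 2 * J / r with hEdef
  set Q := q r - I * (l / r ^ 3) - J / r ^ 3 with hQdef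
  have hY0 : 0 < Y := Real.rpow_pos_of_pos hr0 _
  have hX : r ^ (-1 - β) = r ^ 2 * Y := by
    rw [hY, ← Real.rpow_natCast r 2, ← Real.rpow_add hr0]; congr 1; push_cast; ring
  rw [hX] at hE
  have hΛY : (|l| + 1) / r ^ 4 ≤ Λ * Y := by
    rw [div_le_iff₀ (by positivity)]
    have : Y * r ^ 4 = r ^ (1 - β) := by
      rw [hY, ← Real.rpow_natCast r 4, ← Real.rpow_add hr0]; congr 1; push_cast; ring
    rw [mul_assoc, this]; exact hl
  have h1Y : 1 / r ^ 4 ≤ Λ * Y := le_trans (by gcongr; linarith [abs_nonneg l]) hΛY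
  have hΛY0 : 0 ≤ Λ * Y := le_trans (by positivity) h1Y
  have hlY : |l + 1| / r ^ 4 ≤ Λ * Y := le_trans (by
    gcongr; exact (abs_add_le _ _).trans (by simp)) hΛY
  have hlY' : |l| / r ^ 4 ≤ Λ * Y := le_trans (by gcongr; linarith) hΛY
  have e : 2 * d * q r - 2 * M * d ^ 2 * G r / r ^ 3 - 2 * I * (l / r ^ 3)
      - (2 * J - 2 * M * c) / r ^ 3 =
      2 * d * Q + 2 * (d - 1) * (I * l / r ^ 3) + 2 * (d - 1) * (J / r ^ 3)
      + 2 * M * d ^ 2 / r ^ 3 * (2 * I * ((l + 1) / r)) + 2 * M * d ^ 2 / r ^ 3 * (2 * J / r)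
      - 2 * M * d ^ 2 / r ^ 3 * E - 2 * M / r ^ 3 * c * ((d - 1) * (d + 1)) := by
    rw [hEdef, hQdef]; ring
  have hd2 : 2 * M * d ^ 2 ≤ 2 * R := by
    have : d ^ 2 ≤ 2 ^ 2 := by gcongr
    nlinarith
  have t1 : |2 * d * Q| ≤ 4 * P * Y := by
    rw [abs_mul, abs_of_pos (by positivity)]
    calc 2 * d * |Q| ≤ 2 * 2 * (P * Y) := by gcongr
      _ = _ := by ring
  have t2 : |2 * (d - 1) * (I * l / r ^ 3)| ≤ |I| * (2 * R * (Λ * Y)) := by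
    rw [abs_mul, abs_mul, abs_div, abs_mul, abs_two, abs_of_pos (by positivity : 0 < r ^ 3)]
    calc 2 * |d - 1| * (|I| * |l| / r ^ 3) ≤ 2 * (R / r) * (|I| * |l| / r ^ 3) := by gcongr
      _ = |I| * (2 * R * (|l| / r ^ 4)) := by ring
      _ ≤ _ := by gcongr
  have t3 : |2 * (d - 1) * (J / r ^ 3)| ≤ |J| * (2 * R * (Λ * Y)) := by
    rw [abs_mul, abs_mul, abs_div, abs_two, abs_of_pos (by positivity : 0 < r ^ 3)]
    calc 2 * |d - 1| * (|J| / r ^ 3) ≤ 2 * (R / r) * (|J| / r ^ 3) := by gcongr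
      _ = |J| * (2 * R * (1 / r ^ 4)) := by ring
      _ ≤ _ := by gcongr
  have hpre : 0 < 2 * M * d ^ 2 / r ^ 3 := by positivity
  have t4 : |2 * M * d ^ 2 / r ^ 3 * (2 * I * ((l + 1) / r))| ≤ |I| * (4 * R * (Λ * Y)) := by
    rw [abs_mul, abs_of_pos hpre, abs_mul, abs_mul, abs_div, abs_two, abs_of_pos hr0]
    calc 2 * M * d ^ 2 / r ^ 3 * (2 * |I| * (|l + 1| / r))
        ≤ 2 * R / r ^ 3 * (2 * |I| * (|l + 1| / r)) := by gcongr
      _ = |I| * (4 * R * (|l + 1| / r ^ 4)) := by ring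
      _ ≤ _ := by gcongr
  have t5 : |2 * M * d ^ 2 / r ^ 3 * (2 * J / r)| ≤ |J| * (4 * R * (Λ * Y)) := by
    rw [abs_mul, abs_of_pos hpre, abs_div, abs_mul, abs_two, abs_of_pos hr0]
    calc 2 * M * d ^ 2 / r ^ 3 * (2 * |J| / r)
        ≤ 2 * R / r ^ 3 * (2 * |J| / r) := by gcongr
      _ = |J| * (4 * R * (1 / r ^ 4)) := by ring
      _ ≤ _ := by gcongr
  have t6 : |2 * M * d ^ 2 / r ^ 3 * E| ≤ 4 * P * Y := by
    rw [abs_mul, abs_of_pos hpre]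
    calc 2 * M * d ^ 2 / r ^ 3 * |E| ≤ 2 * R / r ^ 3 * (2 * P * (r ^ 2 * Y)) := by gcongr
      _ = R / r * (4 * P * Y) := by field_simp; ring
      _ ≤ 1 * (4 * P * Y) := by
        gcongr
        exact (div_le_one hr0).2 hr
      _ = _ := one_mul _
  have t7 : |2 * M / r ^ 3 * c * ((d - 1) * (d + 1))| ≤ |c| * (2 * R ^ 2 * (Λ * Y)) := by
    rw [abs_mul, abs_mul, abs_mul, abs_of_pos (by positivity : 0 < 2 * M / r ^ 3),
      abs_of_pos (by positivity : 0 < d + 1)]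
    have : 2 * M ≤ R / 2 := by linarith
    calc 2 * M / r ^ 3 * |c| * (|d - 1| * (d + 1))
        ≤ R / 2 / r ^ 3 * |c| * (R / r * 4) := by gcongr; linarith
      _ = |c| * (2 * R ^ 2 * (1 / r ^ 4)) := by ring
      _ ≤ _ := by gcongr
  rw [e]
  generalize 2 * d * Q = a1 at *
  generalize 2 * (d - 1) * (I * l / r ^ 3) = a2 at *
  generalize 2 * (d - 1) * (J / r ^ 3) = a3 at *
  generalize 2 * M * d ^ 2 / r ^ 3 * (2 * I * ((l + 1) / r)) = a4 at *
  generalize 2 * M * d ^ 2 / r ^ 3 * (2 * J / r) = a5 at *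
  generalize 2 * M * d ^ 2 / r ^ 3 * E = a6 at *
  generalize 2 * M / r ^ 3 * c * ((d - 1) * (d + 1)) = a7 at *
  have f1 : |c| * (2 * R ^ 2 * (Λ * Y)) ≤ (P + |I| + |J| + |c|) * (2 * R ^ 2 * (Λ * Y)) := by
    gcongr; linarith [abs_nonneg I, abs_nonneg J]
  have f2 : (|I| + |J|) * (6 * R * (Λ * Y)) ≤ (P + |I| + |J| + |c|) * (6 * R * (Λ * Y)) :=
    mul_le_mul_of_nonneg_right (by linarith [abs_nonneg c]) (by positivity)
  have f3 : P * (8 * Y) ≤ (P + |I| + |J| + |c|) * (8 * Y) := by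
    gcongr; linarith [abs_nonneg I, abs_nonneg J, abs_nonneg c]
  rw [abs_le] at *
  constructor <;> linarith

end Asymptotics
-- The metric function and piecewise smooth slopes
theorem D_pos {M r : ℝ} (hM : 0 < M) (hr : 2 * M < r) : 0 < D M r := by
  have : 0 < r := by linarith
  unfold D
  rw [sub_pos, div_lt_one this]
  exact hr

theorem D_mul_self {M r : ℝ} (hr : r ≠ 0) : D M r * r = r - 2 * M := by
  unfold D; field_simp

theorem hasDerivAt_D {M r : ℝ} (hr : r ≠ 0) : HasDerivAt (D M) (2 * M / r ^ 2) r := by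
  have := ((hasDerivAt_const r (2 * M)).div (hasDerivAt_id r) hr).const_sub 1
  refine this.congr_deriv ?_
  simp [neg_div]

theorem continuousOn_D (M : ℝ) : ContinuousOn (D M) (Ioi 0) :=
  fun _ hr => (hasDerivAt_D (ne_of_gt hr)).continuousAt.continuousWithinAt

theorem PiecewiseSmooth.intervalIntegrable {h : ℝ → ℝ} {a b : ℝ} (H : PiecewiseSmooth h a b) :
    IntervalIntegrable h MeasureTheory.volume a b := by
  obtain ⟨n, t, rfl, rfl, ht⟩ := H
  refine IntervalIntegrable.trans_iterate fun i hi => ?_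
  obtain ⟨hlt, g, hg, hgh⟩ := ht i hi
  have h1 : IntervalIntegrable g MeasureTheory.volume (t i) (t (i + 1)) := by
    apply ContinuousOn.intervalIntegrable
    rw [uIcc_of_le hlt.le]
    exact hg.continuousOn
  rw [intervalIntegrable_iff_integrableOn_Ioo_of_le hlt.le] at h1 ⊢
  exact h1.congr_fun hgh.symm measurableSet_Ioo

theorem PiecewiseSmooth.exists_finite_continuousAt {h : ℝ → ℝ} {a b : ℝ}
    (H : PiecewiseSmooth h a b) :
    ∃ B : Set ℝ, B.Finite ∧ ∀ r ∈ Ioo a b, r ∉ B → ContinuousAt h r := by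
  obtain ⟨n, t, rfl, rfl, ht⟩ := H
  -- The exceptional set is the set of breakpoints; any other point lies in the open interior of a
  -- piece.
  refine ⟨t '' Iic n, (finite_Iic n).image t, fun r hr hB => ?_⟩
  have key : ∀ m ≤ n, r < t m → ∃ i < n, r ∈ Ioo (t i) (t (i + 1)) := by
    intro m
    induction m with
    | zero => intro _ h; exact absurd hr.1 (not_lt.2 h.le)
    | succ k ih =>
      intro hk h
      rcases lt_trichotomy r (t k) with h1 | h1 | h1
      · exact ih (by omega) h1
      · exact absurd ⟨k, by simp; omega, h1.symm⟩ hB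
      · exact ⟨k, by omega, h1, h⟩
  obtain ⟨i, hi, hri⟩ := key n le_rfl hr.2
  obtain ⟨-, g, hg, hgh⟩ := ht i hi
  have h1 : ContinuousAt g r := hg.continuousOn.continuousAt (Icc_mem_nhds hri.1 hri.2)
  refine h1.congr ?_
  filter_upwards [Ioo_mem_nhds hri.1 hri.2] with s hs using (hgh hs).symm

/-! ### The height function and the causal future of the slice -/

namespace Slice

variable {M R : ℝ} (S : Slice M R)

theorem two_mul_lt_R {M R : ℝ} (S : Slice M R) : 2 * M < R := by
  have := S.two_mul_lt_rH; have := S.rH_lt; have := S.lt_R; linarith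

theorem rH_lt_R : S.rH < R := S.rH_lt.trans S.lt_R

/-- An upper bound for `h`. -/
noncomputable def slope : ℝ := 2 / D M S.rH

theorem slope_pos (hM : 0 < M) : 0 < S.slope := div_pos two_pos (D_pos hM S.two_mul_lt_rH)

theorem two_div_D_le_slope (hM : 0 < M) {r : ℝ} (hr : S.rH ≤ r) : 2 / D M r ≤ S.slope := by
  have h1 := S.two_mul_lt_rH
  have h2 := D_pos hM h1
  unfold slope
  gcongr
  unfold D
  have : 2 * M / r ≤ 2 * M / S.rH := by
    have : 0 < S.rH := by linarith
    gcongr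
  linarith

theorem h_bounds (hM : 0 < M) {r : ℝ} (hr : 2 * M ≤ r) : 0 ≤ S.h r ∧ S.h r ≤ S.slope := by
  rcases le_or_gt r S.rH with h1 | h1
  · rw [S.h_horizon r ⟨hr, h1⟩]; exact ⟨le_rfl, (S.slope_pos hM).le⟩
  rcases lt_or_ge r R with h2 | h2
  · obtain ⟨h3, h4⟩ := S.h_spacelike r ⟨h1, h2⟩
    exact ⟨h3.le, h4.le.trans (S.two_div_D_le_slope hM h1.le)⟩
  · rw [S.h_infinity r h2]
    exact ⟨(div_pos two_pos (D_pos hM (S.two_mul_lt_R.trans_le h2))).le,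
      S.two_div_D_le_slope hM h1.le⟩

theorem continuousAt_two_div_D (hM : 0 < M) {r : ℝ} (hr : 2 * M < r) :
    ContinuousAt (fun s => 2 / D M s) r :=
  continuousAt_const.div (hasDerivAt_D (by linarith)).continuousAt (D_pos hM hr).ne'

theorem intervalIntegrable_two_div_D (hM : 0 < M) {a b : ℝ} (ha : 2 * M < a) (hb : 2 * M < b) :
    IntervalIntegrable (fun s => 2 / D M s) MeasureTheory.volume a b :=
  ContinuousOn.intervalIntegrable fun _ hs =>
    (continuousAt_two_div_D hM ((lt_min ha hb).trans_le hs.1)).continuousWithinAt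

theorem intervalIntegrable_h_rH {r : ℝ} (h1 : 2 * M ≤ r) (h2 : r ≤ S.rH) :
    IntervalIntegrable S.h MeasureTheory.volume (2 * M) r := by
  refine (intervalIntegrable_const (c := (0 : ℝ))).congr fun s hs => ?_
  rw [uIoc_of_le h1] at hs
  exact (S.h_horizon s ⟨hs.1.le, hs.2.trans h2⟩).symm

theorem intervalIntegrable_h_R (hM : 0 < M) {r : ℝ} (hr : R ≤ r) :
    IntervalIntegrable S.h MeasureTheory.volume R r := by
  refine (intervalIntegrable_two_div_D hM S.two_mul_lt_R
    (S.two_mul_lt_R.trans_le hr)).congr fun s hs => ?_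
  rw [uIoc_of_le hr] at hs
  exact (S.h_infinity s hs.1.le).symm

theorem intervalIntegrable_h (hM : 0 < M) {a b : ℝ} (ha : 2 * M ≤ a) (hb : 2 * M ≤ b) :
    IntervalIntegrable S.h MeasureTheory.volume a b := by
  have main : ∀ r, 2 * M ≤ r → IntervalIntegrable S.h MeasureTheory.volume (2 * M) r := by
    intro r hr
    have h1 := ((S.intervalIntegrable_h_rH S.two_mul_lt_rH.le le_rfl).trans
      S.h_smooth.intervalIntegrable).trans
      (S.intervalIntegrable_h_R hM (le_max_right r R))
    refine h1.mono_set ?_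
    rw [uIcc_of_le hr, uIcc_of_le (hr.trans (le_max_left r R))]
    exact Icc_subset_Icc le_rfl (le_max_left r R)
  exact (main a ha).symm.trans (main b hb)

theorem height_sub (hM : 0 < M) {a b : ℝ} (ha : 2 * M ≤ a) (hb : 2 * M ≤ b) :
    S.height b = S.height a + ∫ s in a..b, S.h s := by
  unfold height
  rw [add_assoc, intervalIntegral.integral_add_adjacent_intervals
    (S.intervalIntegrable_h hM le_rfl ha) (S.intervalIntegrable_h hM ha hb)]

theorem height_le (hM : 0 < M) {a b : ℝ} (ha : 2 * M ≤ a) (hab : a ≤ b) :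
    S.height b ≤ S.height a + S.slope * (b - a) := by
  rw [S.height_sub hM ha (ha.trans hab)]
  have := intervalIntegral.integral_mono_on hab (S.intervalIntegrable_h hM ha (ha.trans hab))
    intervalIntegrable_const (fun s hs => (S.h_bounds hM (ha.trans hs.1)).2)
  rw [intervalIntegral.integral_const, smul_eq_mul] at this
  linarith

theorem height_mono (hM : 0 < M) {a b : ℝ} (ha : 2 * M ≤ a) (hab : a ≤ b) :
    S.height a ≤ S.height b := by
  rw [S.height_sub hM ha (ha.trans hab)]
  have := intervalIntegral.integral_nonneg (μ := MeasureTheory.volume) hab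
    (fun s hs => (S.h_bounds hM (ha.trans hs.1)).1)
  linarith

theorem height_eq_of_le_rH {r : ℝ} (h1 : 2 * M ≤ r) (h2 : r ≤ S.rH) :
    S.height r = S.v₀ := by
  unfold height
  rw [intervalIntegral.integral_congr (g := fun _ => 0)]
  · simp
  · intro s hs
    rw [uIcc_of_le h1] at hs
    exact S.h_horizon s ⟨hs.1, hs.2.trans h2⟩

theorem hasDerivAt_height (hM : 0 < M) {r : ℝ} (hr : 2 * M < r) (hc : ContinuousAt S.h r) :
    HasDerivAt S.height (S.h r) r := by
  unfold height
  refine (intervalIntegral.integral_hasDerivAt_right (S.intervalIntegrable_h hM le_rfl hr.le)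
    ?_ hc).const_add _
  have h1 := (S.intervalIntegrable_h hM le_rfl (b := r + 1) (by linarith))
  rw [intervalIntegrable_iff_integrableOn_Ioo_of_le (by linarith)] at h1
  exact ⟨Ioo (2 * M) (r + 1), Ioo_mem_nhds hr (by linarith), h1.aestronglyMeasurable⟩

theorem hasDerivWithinAt_height (hM : 0 < M) {r : ℝ} (hr : R ≤ r) :
    HasDerivWithinAt S.height (2 / D M r) (Ici R) r := by
  have h1 : HasDerivAt (fun x => S.height R + ∫ s in R..x, 2 / D M s) (2 / D M r) r := by
    refine (intervalIntegral.integral_hasDerivAt_right (intervalIntegrable_two_div_D hM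
      S.two_mul_lt_R (S.two_mul_lt_R.trans_le hr)) ?_
      (continuousAt_two_div_D hM (S.two_mul_lt_R.trans_le hr))).const_add _
    refine ContinuousOn.stronglyMeasurableAtFilter isOpen_Ioi (s := Ioi (2 * M)) ?_ r
      (S.two_mul_lt_R.trans_le hr)
    exact fun s hs => (continuousAt_two_div_D hM hs).continuousWithinAt
  refine h1.hasDerivWithinAt.congr_of_mem (fun x hx => ?_) hr
  rw [S.height_sub hM S.two_mul_lt_R.le (S.two_mul_lt_R.le.trans hx)]
  congr 1
  refine intervalIntegral.integral_congr fun s hs => ?_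
  rw [uIcc_of_le hx] at hs
  exact S.h_infinity s hs.1

/-- The exceptions are the breakpoints of `h` and the radii `S.rH` and `R`, where `h` may jump. A
finite set is harmless for the fundamental theorem of calculus applied to continuous functions. -/
theorem exists_finite_hasDerivAt_height (hM : 0 < M) :
    ∃ B : Set ℝ, B.Finite ∧ ∀ r, 2 * M < r → r ∉ B → HasDerivAt S.height (S.h r) r := by
  obtain ⟨B, hB, h⟩ := S.h_smooth.exists_finite_continuousAt
  refine ⟨B ∪ {S.rH, R}, hB.union (by simp), fun r hr hrB => S.hasDerivAt_height hM hr ?_⟩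
  simp only [mem_union, mem_insert_iff, mem_singleton_iff, not_or] at hrB
  rcases lt_or_gt_of_ne hrB.2.1 with h1 | h1
  · refine (continuousAt_const (y := (0 : ℝ))).congr ?_
    filter_upwards [Ioo_mem_nhds hr h1] with s hs
    exact (S.h_horizon s ⟨hs.1.le, hs.2.le⟩).symm
  rcases lt_or_gt_of_ne hrB.2.2 with h2 | h2
  · exact h r ⟨h1, h2⟩ hrB.1
  · refine (continuousAt_two_div_D hM hr).congr ?_
    filter_upwards [Ioi_mem_nhds h2] with s hs
    exact (S.h_infinity s (le_of_lt hs)).symm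

theorem continuousOn_height (hM : 0 < M) : ContinuousOn S.height (Ici (2 * M)) := by
  have hl : LipschitzOnWith S.slope.toNNReal S.height (Ici (2 * M)) := by
    refine LipschitzOnWith.of_le_add_mul _ fun x hx y hy => ?_
    rw [Real.coe_toNNReal _ (S.slope_pos hM).le, Real.dist_eq]
    rcases le_total y x with h | h
    · rw [abs_of_nonneg (by linarith)]; exact S.height_le hM hy h
    · have := S.height_mono hM hx h
      have := mul_nonneg (S.slope_pos hM).le (abs_nonneg (x - y))
      linarith
  exact hl.continuousOn

/-- The part of `J⁺(Σ₀)` away from the horizon. -/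
def exterior : Set (ℝ × ℝ) := S.future ∩ {p | 2 * M < p.2}

/-- The interior of `J⁺(Σ₀)`. -/
def core : Set (ℝ × ℝ) := {p | 2 * M < p.2 ∧ S.height p.2 < p.1}

theorem core_subset_exterior : S.core ⊆ S.exterior := fun _ hp => ⟨⟨hp.1.le, hp.2.le⟩, hp.1⟩

theorem exterior_subset_future : S.exterior ⊆ S.future := inter_subset_left

theorem isOpen_core (hM : 0 < M) : IsOpen S.core := by
  rw [isOpen_iff_mem_nhds]
  rintro ⟨v, r⟩ ⟨h1, h2⟩
  have hc : ContinuousAt (fun p : ℝ × ℝ => p.1 - S.height p.2) (v, r) := by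
    refine continuousAt_fst.sub (ContinuousAt.comp (f := Prod.snd) (g := S.height) ?_
      continuousAt_snd)
    exact (S.continuousOn_height hM).continuousAt (Ici_mem_nhds h1)
  filter_upwards [hc.eventually_const_lt (u := 0) (by simpa using h2),
    continuousAt_snd.eventually_const_lt (u := 2 * M) h1] with p h3 h4
  exact ⟨h4, by linarith⟩

theorem pt_mem_future {r : ℝ} (hr : 2 * M ≤ r) : S.pt r ∈ S.future := ⟨hr, le_rfl⟩

theorem pt_mem_exterior {r : ℝ} (hr : 2 * M < r) : S.pt r ∈ S.exterior :=
  ⟨S.pt_mem_future hr.le, hr⟩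

/-- One-sided derivatives on the boundary are meaningful because the height is Lipschitz: a cone of
fixed aperture fits inside the future at each of its points. -/
theorem uniqueDiffOn_future (hM : 0 < M) : UniqueDiffOn ℝ S.future := by
  intro p hp
  -- The cone opens towards larger `r`, which keeps it in `r ≥ 2M`; its lower edge rises at the
  -- maximal slope of the height, which keeps it above `Σ₀`.
  set K : Set (ℝ × ℝ) := {q | p.2 ≤ q.2 ∧ p.1 + S.slope * (q.2 - p.2) ≤ q.1} with hK
  have hsub : K ⊆ S.future := fun q hq => by
    refine ⟨hp.1.trans hq.1, (S.height_le hM hp.1 hq.1).trans ?_⟩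
    have := hp.2
    have := hq.2
    linarith
  have hconv : Convex ℝ K := by
    intro x hx y hy a b ha hb hab
    have hb' : b = 1 - a := by linarith
    subst hb'
    constructor
    · have := mul_le_mul_of_nonneg_left hx.1 ha
      have := mul_le_mul_of_nonneg_left hy.1 hb
      simp only [Prod.snd_add, Prod.smul_snd, smul_eq_mul]
      linarith
    · have := mul_le_mul_of_nonneg_left hx.2 ha
      have := mul_le_mul_of_nonneg_left hy.2 hb
      simp only [Prod.snd_add, Prod.smul_snd, Prod.fst_add, Prod.smul_fst, smul_eq_mul]
      linarith
  have hint : (interior K).Nonempty := by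
    refine ⟨(p.1 + S.slope + 1, p.2 + 1), mem_interior.2
      ⟨{q | p.2 < q.2 ∧ p.1 + S.slope * (q.2 - p.2) < q.1}, fun q hq => ⟨hq.1.le, hq.2.le⟩, ?_,
        by simp, by simp⟩⟩
    exact (isOpen_lt continuous_const continuous_snd).inter
      (isOpen_lt (by fun_prop) continuous_fst)
  exact (uniqueDiffWithinAt_convex hconv hint (subset_closure ⟨le_rfl, by simp⟩)).mono hsub

theorem uniqueDiffOn_exterior (hM : 0 < M) : UniqueDiffOn ℝ S.exterior :=
  (S.uniqueDiffOn_future hM).inter (isOpen_lt continuous_const continuous_snd)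

/-- Two continuous functions on the exterior that agree in the interior of `J⁺(Σ₀)` agree. -/
theorem eqOn_exterior_of_core {f g : ℝ × ℝ → ℝ} (hf : ContinuousOn f S.exterior)
    (hg : ContinuousOn g S.exterior) (h : EqOn f g S.core) : EqOn f g S.exterior := by
  rintro ⟨v, r⟩ hp
  -- Moving by a positive amount in `v` leads from any exterior point into the interior.
  have ht : Tendsto (fun e : ℝ => (v + e, r)) (𝓝[>] 0) (𝓝[S.exterior] (v, r)) := by
    refine tendsto_nhdsWithin_iff.2 ⟨?_, ?_⟩
    · refine Tendsto.mono_left ?_ nhdsWithin_le_nhds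
      have : Continuous fun e : ℝ => (v + e, r) := by fun_prop
      simpa using this.tendsto 0
    · filter_upwards [self_mem_nhdsWithin] with e he
      exact ⟨⟨hp.1.1, hp.1.2.trans (by simpa using le_of_lt he)⟩, hp.2⟩
  have h1 := (hf _ hp).tendsto.comp ht
  have h2 := (hg _ hp).tendsto.comp ht
  refine tendsto_nhds_unique_of_eventuallyEq h1 h2 ?_
  filter_upwards [self_mem_nhdsWithin] with e he
  exact h ⟨hp.2, hp.1.2.trans_lt (by simpa using he)⟩

end Slice
-- The wave operator on spherically symmetric functions
theorem metric_det (M : ℝ) (x : Fin 4 → ℝ) :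
    (metric M x).det = -(x 1 ^ 2 * Real.sin (x 2)) ^ 2 := by
  simp [metric, Matrix.det_succ_row_zero, Fin.sum_univ_succ, Fin.succAbove]
  ring

theorem sqrt_abs_metric_det (M : ℝ) (x : Fin 4 → ℝ) :
    √|(metric M x).det| = x 1 ^ 2 * |Real.sin (x 2)| := by
  rw [metric_det, abs_neg, abs_of_nonneg (sq_nonneg _), Real.sqrt_sq_eq_abs, abs_mul,
    abs_of_nonneg (sq_nonneg _)]

theorem metric_inv (M : ℝ) {x : Fin 4 → ℝ} (h1 : x 1 ≠ 0) (h2 : Real.sin (x 2) ≠ 0) :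
    (metric M x)⁻¹ = !![0, 1, 0, 0; 1, D M (x 1), 0, 0; 0, 0, (x 1 ^ 2)⁻¹, 0;
      0, 0, 0, (x 1 ^ 2 * Real.sin (x 2) ^ 2)⁻¹] := by
  apply Matrix.inv_eq_right_inv
  ext i j
  fin_cases i <;> fin_cases j <;> simp [metric, Matrix.mul_apply, Fin.sum_univ_succ, h1]
  field_simp

theorem pd_eq_of_hasDerivAt {i : Fin 4} {F : (Fin 4 → ℝ) → ℝ} {x : Fin 4 → ℝ} {g : ℝ → ℝ} {c : ℝ}
    (hg : HasDerivAt g c (x i)) (h : ∀ᶠ s in 𝓝 (x i), F (Function.update x i s) = g s) :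
    pd i F x = c :=
  (hg.congr_of_eventuallyEq h).deriv

/-- The wave equation for a spherically symmetric `C²` function, as a conservation law. -/
theorem wave_eq_of_box_eq_zero {M : ℝ} {f : ℝ × ℝ → ℝ} {v r θ α : ℝ} (hr : 0 < r)
    (hθ : Real.sin θ ≠ 0) (hf : ContDiffAt ℝ 2 f (v, r))
    (hbox : box (metric M) (lift f) ![v, r, θ, α] = 0) :
    r ^ 2 * fderiv ℝ (fun p => fderiv ℝ f p (0, 1)) (v, r) (1, 0) +
      (2 * r * (fderiv ℝ f (v, r) (1, 0) + D M r * fderiv ℝ f (v, r) (0, 1)) +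
      r ^ 2 * (fderiv ℝ (fun p => fderiv ℝ f p (1, 0)) (v, r) (0, 1) +
        (2 * M / r ^ 2 * fderiv ℝ f (v, r) (0, 1) +
        D M r * fderiv ℝ (fun p => fderiv ℝ f p (0, 1)) (v, r) (0, 1)))) = 0 := by
  have hfd : ContDiffAt ℝ 1 (fderiv ℝ f) (v, r) := hf.fderiv_right (by norm_num)
  have hev : ∀ᶠ p in 𝓝 (v, r), DifferentiableAt ℝ f p := by
    filter_upwards [hf.eventually (by simp)] with p hp using hp.differentiableAt (by simp)
  have hvline : HasDerivAt (fun s : ℝ => (s, r)) ((1 : ℝ), (0 : ℝ)) v :=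
    (hasDerivAt_id v).prodMk (hasDerivAt_const v r)
  have hrline : HasDerivAt (fun s : ℝ => (v, s)) ((0 : ℝ), (1 : ℝ)) r :=
    (hasDerivAt_const r v).prodMk (hasDerivAt_id r)
  have hA (w : ℝ × ℝ) : DifferentiableAt ℝ (fun p => fderiv ℝ f p w) (v, r) :=
    (hfd.differentiableAt (by simp)).clm_apply (differentiableAt_const w)
  have pd0 : ∀ y : Fin 4 → ℝ, DifferentiableAt ℝ f (y 0, y 1) →
      pd 0 (lift f) y = fderiv ℝ f (y 0, y 1) (1, 0) := by
    intro y hy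
    have h1 : HasDerivAt (fun s : ℝ => (s, y 1)) ((1 : ℝ), (0 : ℝ)) (y 0) :=
      (hasDerivAt_id _).prodMk (hasDerivAt_const _ _)
    have := hy.hasFDerivAt.comp_hasDerivAt (y 0) h1
    simpa [pd, lift, Function.comp_def] using this.deriv
  have pd1 : ∀ y : Fin 4 → ℝ, DifferentiableAt ℝ f (y 0, y 1) →
      pd 1 (lift f) y = fderiv ℝ f (y 0, y 1) (0, 1) := by
    intro y hy
    have h1 : HasDerivAt (fun s : ℝ => (y 0, s)) ((0 : ℝ), (1 : ℝ)) (y 1) :=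
      (hasDerivAt_const _ _).prodMk (hasDerivAt_id _)
    have := hy.hasFDerivAt.comp_hasDerivAt (y 1) h1
    simpa [pd, lift, Function.comp_def] using this.deriv
  have pd2 : ∀ y : Fin 4 → ℝ, pd 2 (lift f) y = 0 := by intro y; simp [pd, lift]
  have pd3 : ∀ y : Fin 4 → ℝ, pd 3 (lift f) y = 0 := by intro y; simp [pd, lift]
  set x : Fin 4 → ℝ := ![v, r, θ, α] with hx
  -- The volume density is `r² |sin θ|`; its angular factor is constant under `∂_v` and `∂_r` and is
  -- cancelled at the end.
  set σ := |Real.sin θ| with hσ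
  have hσ0 : σ ≠ 0 := abs_ne_zero.2 hθ
  have b0 : pd 0 (fun y => √|(metric M y).det| * ∑ j, (metric M y)⁻¹ 0 j * pd j (lift f) y) x =
      σ * (r ^ 2 * fderiv ℝ (fun p => fderiv ℝ f p (0, 1)) (v, r) (1, 0)) := by
    have h1 := ((hA (0, 1)).hasFDerivAt.comp_hasDerivAt v hvline).const_mul (r ^ 2 * σ)
    refine (pd_eq_of_hasDerivAt (x := x) h1 ?_).trans (by ring)
    filter_upwards [hvline.continuousAt.eventually hev] with s hs
    rw [sqrt_abs_metric_det, metric_inv M (by simpa [hx] using hr.ne') (by simpa [hx] using hθ)]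
    rw [Fin.sum_univ_four, pd1 (Function.update x 0 s) (by simpa [hx] using hs)]
    simp [hx, hσ]
  have b1 : pd 1 (fun y => √|(metric M y).det| * ∑ j, (metric M y)⁻¹ 1 j * pd j (lift f) y) x =
      σ * (2 * r * (fderiv ℝ f (v, r) (1, 0) + D M r * fderiv ℝ f (v, r) (0, 1)) +
      r ^ 2 * (fderiv ℝ (fun p => fderiv ℝ f p (1, 0)) (v, r) (0, 1) +
        (2 * M / r ^ 2 * fderiv ℝ f (v, r) (0, 1) +
        D M r * fderiv ℝ (fun p => fderiv ℝ f p (0, 1)) (v, r) (0, 1)))) := by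
    have h1 := ((hasDerivAt_pow 2 r).mul (((hA (1, 0)).hasFDerivAt.comp_hasDerivAt r hrline).add
      ((hasDerivAt_D (M := M) hr.ne').mul
        ((hA (0, 1)).hasFDerivAt.comp_hasDerivAt r hrline)))).const_mul σ
    refine (pd_eq_of_hasDerivAt (x := x) h1 ?_).trans ?_
    · filter_upwards [hrline.continuousAt.eventually hev, lt_mem_nhds hr] with s hs hs0
      rw [sqrt_abs_metric_det, metric_inv M (by simpa [hx] using hs0.ne') (by simpa [hx] using hθ)]
      rw [Fin.sum_univ_four, pd0 (Function.update x 1 s) (by simpa [hx] using hs),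
        pd1 (Function.update x 1 s) (by simpa [hx] using hs)]
      simp [hx, hσ]
      ring
    · simp [Function.comp_def]
  -- The inverse metric has no entries mixing angles with `v` and `r`, so the angular components of
  -- the gradient vanish identically nearby.
  have b2 : pd 2 (fun y => √|(metric M y).det| * ∑ j, (metric M y)⁻¹ 2 j * pd j (lift f) y) x =
      0 := by
    refine pd_eq_of_hasDerivAt (hasDerivAt_const _ (0 : ℝ)) ?_
    have : ∀ᶠ s in 𝓝 (x 2), Real.sin s ≠ 0 :=
      Real.continuous_sin.continuousAt.eventually_ne (by simpa [hx] using hθ)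
    filter_upwards [this] with s hs
    rw [metric_inv M (by simpa [hx] using hr.ne') (by simpa [hx] using hs), Fin.sum_univ_four,
      pd2]
    simp
  have b3 : pd 3 (fun y => √|(metric M y).det| * ∑ j, (metric M y)⁻¹ 3 j * pd j (lift f) y) x =
      0 := by
    refine pd_eq_of_hasDerivAt (hasDerivAt_const _ (0 : ℝ)) ?_
    refine Eventually.of_forall fun s => ?_
    rw [metric_inv M (by simpa [hx] using hr.ne') (by simpa [hx] using hθ), Fin.sum_univ_four,
      pd3]
    simp
  unfold box at hbox
  rw [Fin.sum_univ_four, b0, b1, b2, b3, sqrt_abs_metric_det] at hbox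
  have hpos : (x 1 ^ 2 * |Real.sin (x 2)|)⁻¹ ≠ 0 := by
    simp [hx, hr.ne', hθ]
  have := (mul_eq_zero.1 hbox).resolve_left hpos
  rw [add_zero, add_zero, ← mul_add] at this
  exact (mul_eq_zero.1 this).resolve_left hσ0

/-! ### One-sided derivatives along the slice -/

namespace Slice

variable {M R : ℝ} (S : Slice M R)

theorem fderivWithin_exterior (f : ℝ × ℝ → ℝ) {p : ℝ × ℝ} (hp : p ∈ S.exterior) :
    fderivWithin ℝ f S.exterior p = fderivWithin ℝ f S.future p :=
  fderivWithin_inter ((isOpen_lt continuous_const continuous_snd).mem_nhds hp.2)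

theorem differentiableWithinAt_future_of_exterior {f : ℝ × ℝ → ℝ} {p : ℝ × ℝ}
    (hp : p ∈ S.exterior) (hf : DifferentiableWithinAt ℝ f S.exterior p) :
    DifferentiableWithinAt ℝ f S.future p :=
  (differentiableWithinAt_inter
    ((isOpen_lt continuous_const continuous_snd).mem_nhds hp.2)).1 hf

theorem fderivWithin_core (hM : 0 < M) (f : ℝ × ℝ → ℝ) {p : ℝ × ℝ} (hp : p ∈ S.core) :
    fderivWithin ℝ f S.future p = fderiv ℝ f p :=
  fderivWithin_of_mem_nhds (mem_of_superset ((S.isOpen_core hM).mem_nhds hp)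
    (S.core_subset_exterior.trans S.exterior_subset_future))

theorem contDiffOn_fderivWithin {f : ℝ × ℝ → ℝ} (hM : 0 < M)
    (hf : ContDiffOn ℝ 2 f S.exterior) (w : ℝ × ℝ) :
    ContDiffOn ℝ 1 (fun p => fderivWithin ℝ f S.future p w) S.exterior := by
  have h1 := (hf.fderivWithin (m := 1) (S.uniqueDiffOn_exterior hM) (by norm_num)).clm_apply
    (contDiffOn_const (c := w))
  exact h1.congr fun p hp => by rw [S.fderivWithin_exterior f hp]

theorem continuousOn_fderivWithin {f : ℝ × ℝ → ℝ} (hM : 0 < M)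
    (hf : ContDiffOn ℝ 1 f S.exterior) (w : ℝ × ℝ) :
    ContinuousOn (fun p => fderivWithin ℝ f S.future p w) S.exterior := by
  have h1 := (hf.continuousOn_fderivWithin (S.uniqueDiffOn_exterior hM) (by norm_num)).clm_apply
    (continuousOn_const (c := w))
  exact h1.congr fun p hp => by simp only [S.fderivWithin_exterior f hp]

theorem hasDerivWithinAt_comp_pt {f : ℝ × ℝ → ℝ} {s : Set ℝ} {r h' : ℝ} (hs : s ⊆ Ici (2 * M))
    (hf : DifferentiableWithinAt ℝ f S.future (S.pt r)) (hh : HasDerivWithinAt S.height h' s r) :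
    HasDerivWithinAt (fun x => f (S.pt x)) (S.dr f (S.pt r) + h' * S.dv f (S.pt r)) s r := by
  have h1 : HasDerivWithinAt S.pt (h', 1) s r := hh.prodMk (hasDerivWithinAt_id r s)
  have h2 := hf.hasFDerivWithinAt.comp_hasDerivWithinAt r h1
    (fun x hx => S.pt_mem_future (hs hx))
  refine h2.congr_deriv ?_
  have : ((h', 1) : ℝ × ℝ) = (0, 1) + h' • (1, 0) := by simp
  rw [this, map_add, map_smul]
  rfl

theorem continuousOn_pt (hM : 0 < M) : ContinuousOn S.pt (Ici (2 * M)) :=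
  (S.continuousOn_height hM).prodMk continuousOn_id

/-! ### The wave equation for the time integral and its flux from the horizon to `R` -/

section TimeIntegral

variable {S} {φ φ₁ : ℝ × ℝ → ℝ}

theorem IsSmoothSolution.continuousOn_fderivWithin (hM : 0 < M) (hφ : S.IsSmoothSolution φ)
    (w : ℝ × ℝ) : ContinuousOn (fun p => fderivWithin ℝ φ S.future p w) S.future :=
  (hφ.smooth.continuousOn_fderivWithin (S.uniqueDiffOn_future hM) (by simp)).clm_apply
    continuousOn_const

theorem IsSmoothSolution.differentiableOn (hφ : S.IsSmoothSolution φ) :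
    DifferentiableOn ℝ φ S.future := hφ.smooth.differentiableOn (by simp)

theorem IsTimeIntegral.contDiffAt (hM : 0 < M) (h₁ : S.IsTimeIntegral φ φ₁) {p : ℝ × ℝ}
    (hp : p ∈ S.core) : ContDiffAt ℝ 2 φ₁ p :=
  h₁.regular.contDiffAt
    (mem_of_superset ((S.isOpen_core hM).mem_nhds hp) S.core_subset_exterior)

theorem IsTimeIntegral.dr_eventuallyEq (hM : 0 < M) {p : ℝ × ℝ} (hp : p ∈ S.core) :
    S.dr φ₁ =ᶠ[𝓝 p] fun q => fderiv ℝ φ₁ q (0, 1) := by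
  filter_upwards [(S.isOpen_core hM).mem_nhds hp] with q hq
  rw [dr, S.fderivWithin_core hM _ hq]

theorem IsTimeIntegral.dv_eventuallyEq (hM : 0 < M) (h₁ : S.IsTimeIntegral φ φ₁) {p : ℝ × ℝ}
    (hp : p ∈ S.core) : (fun q => fderiv ℝ φ₁ q (1, 0)) =ᶠ[𝓝 p] φ := by
  filter_upwards [(S.isOpen_core hM).mem_nhds hp] with q hq
  have := h₁.time_deriv q (S.exterior_subset_future (S.core_subset_exterior hq)) hq.1
  rwa [dv, S.fderivWithin_core hM _ hq] at this

/-- Second derivatives of a `C²` function commute, and `∂_v φ₁ = φ` holds in a neighbourhood of an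
interior point, so it may be differentiated in `r`. -/
theorem IsTimeIntegral.dv_dr_core (hM : 0 < M) (h₁ : S.IsTimeIntegral φ φ₁) {p : ℝ × ℝ}
    (hp : p ∈ S.core) : S.dv (S.dr φ₁) p = S.dr φ p := by
  have hc := h₁.contDiffAt hM hp
  have hd : DifferentiableAt ℝ (fderiv ℝ φ₁) p :=
    (hc.fderiv_right (m := 1) (by norm_num)).differentiableAt (by simp)
  have hsymm : IsSymmSndFDerivAt ℝ φ₁ p := hc.isSymmSndFDerivAt (by simp)
  rw [dv, dr, S.fderivWithin_core hM _ hp, S.fderivWithin_core hM _ hp,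
    (dr_eventuallyEq hM hp).fderiv_eq, ← (h₁.dv_eventuallyEq hM hp).fderiv_eq,
    fderiv_clm_apply hd (differentiableAt_const _), fderiv_clm_apply hd (differentiableAt_const _)]
  simpa using hsymm (1, 0) (0, 1)

theorem IsTimeIntegral.wave_core (hM : 0 < M) (h₁ : S.IsTimeIntegral φ φ₁) {p : ℝ × ℝ}
    (hp : p ∈ S.core) :
    p.2 ^ 2 * (D M p.2 * S.dr (S.dr φ₁) p) + 2 * p.2 * (D M p.2 * S.dr φ₁ p) + 2 * M * S.dr φ₁ p =
      -2 * p.2 * φ p - 2 * p.2 ^ 2 * S.dr φ p := by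
  obtain ⟨v, r⟩ := p
  have hr : 0 < r := by have := hp.1; simp only at this; linarith
  -- The reduced equation does not involve the angle; the equator is chosen so that `sin θ ≠ 0`.
  have hw := wave_eq_of_box_eq_zero hr (θ := Real.pi / 2) (by simp) (h₁.contDiffAt hM hp)
    (h₁.wave v r (Real.pi / 2) 0 hp.1 hp.2 ⟨by positivity, by linarith [Real.pi_pos]⟩)
  have e1 := h₁.dv_dr_core hM hp
  have e2 := (h₁.dv_eventuallyEq hM hp).eq_of_nhds
  rw [dv, S.fderivWithin_core hM _ hp, (dr_eventuallyEq hM hp).fderiv_eq] at e1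
  rw [e1, (h₁.dv_eventuallyEq hM hp).fderiv_eq, ← S.fderivWithin_core hM φ hp,
    ← (dr_eventuallyEq hM hp).fderiv_eq, ← S.fderivWithin_core hM (S.dr φ₁) hp,
    ← S.fderivWithin_core hM φ₁ hp] at hw
  rw [← S.fderivWithin_core hM φ₁ hp] at e2
  rw [e2] at hw
  change r ^ 2 * S.dr φ (v, r) + (2 * r * (φ (v, r) + D M r * S.dr φ₁ (v, r)) + r ^ 2 *
    (S.dr φ (v, r) + (2 * M / r ^ 2 * S.dr φ₁ (v, r) + D M r * S.dr (S.dr φ₁) (v, r)))) = 0 at hw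
  have e3 : r ^ 2 * (2 * M / r ^ 2 * S.dr φ₁ (v, r)) = 2 * M * S.dr φ₁ (v, r) := by
    field_simp
  simp only
  linear_combination hw - e3

theorem IsTimeIntegral.contDiffOn_dr (hM : 0 < M) (h₁ : S.IsTimeIntegral φ φ₁) :
    ContDiffOn ℝ 1 (S.dr φ₁) S.exterior := S.contDiffOn_fderivWithin hM h₁.regular (0, 1)

theorem IsTimeIntegral.dv_dr (hM : 0 < M) (hφ : S.IsSmoothSolution φ)
    (h₁ : S.IsTimeIntegral φ φ₁) {p : ℝ × ℝ} (hp : p ∈ S.exterior) :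
    S.dv (S.dr φ₁) p = S.dr φ p :=
  S.eqOn_exterior_of_core (S.continuousOn_fderivWithin hM (h₁.contDiffOn_dr hM) (1, 0))
    ((hφ.continuousOn_fderivWithin hM (0, 1)).mono S.exterior_subset_future)
    (fun _ hq => h₁.dv_dr_core hM hq) hp

theorem continuousOn_D_snd (hM : 0 < M) : ContinuousOn (fun p : ℝ × ℝ => D M p.2) S.exterior :=
  (continuousOn_D M).comp continuousOn_snd fun p hp => by
    have := hp.2
    simp only [mem_ofPred_eq] at this
    exact mem_Ioi.2 (by linarith)

/-- The equation is assumed only in the interior, but it is needed on `Σ₀` itself. Both sides are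
continuous up to `Σ₀` away from the horizon, so it extends. -/
theorem IsTimeIntegral.wave_exterior (hM : 0 < M) (hφ : S.IsSmoothSolution φ)
    (h₁ : S.IsTimeIntegral φ φ₁) {p : ℝ × ℝ} (hp : p ∈ S.exterior) :
    p.2 ^ 2 * (D M p.2 * S.dr (S.dr φ₁) p) + 2 * p.2 * (D M p.2 * S.dr φ₁ p) + 2 * M * S.dr φ₁ p =
      -2 * p.2 * φ p - 2 * p.2 ^ 2 * S.dr φ p := by
  have hD := S.continuousOn_D_snd hM
  have c1 : ContinuousOn (S.dr φ₁) S.exterior := (h₁.contDiffOn_dr hM).continuousOn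
  have c2 : ContinuousOn (S.dr (S.dr φ₁)) S.exterior :=
    S.continuousOn_fderivWithin hM (h₁.contDiffOn_dr hM) (0, 1)
  have c3 : ContinuousOn φ S.exterior := hφ.smooth.continuousOn.mono S.exterior_subset_future
  have c4 : ContinuousOn (S.dr φ) S.exterior :=
    (hφ.continuousOn_fderivWithin hM (0, 1)).mono S.exterior_subset_future
  exact S.eqOn_exterior_of_core
    (f := fun p => p.2 ^ 2 * (D M p.2 * S.dr (S.dr φ₁) p) + 2 * p.2 * (D M p.2 * S.dr φ₁ p)
      + 2 * M * S.dr φ₁ p)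
    (g := fun p => -2 * p.2 * φ p - 2 * p.2 ^ 2 * S.dr φ p)
    (by fun_prop) (by fun_prop) (fun _ hq => h₁.wave_core hM hq) hp

/-- The radial flux `r² D ∂_r φ₁` along `Σ₀`. -/
noncomputable def flux (S : Slice M R) (φ₁ : ℝ × ℝ → ℝ) (r : ℝ) : ℝ :=
  r ^ 2 * D M r * S.dr φ₁ (S.pt r)

/-- Along `Σ₀` the derivative is `∂_r + h' ∂_v`. The wave equation evaluates the `∂_r` part, and
`∂_v ∂_r φ₁ = ∂_r φ` evaluates the other, so only `φ` remains. -/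
theorem IsTimeIntegral.hasDerivWithinAt_flux (hM : 0 < M) (hφ : S.IsSmoothSolution φ)
    (h₁ : S.IsTimeIntegral φ φ₁) {s : Set ℝ} (hs : s ⊆ Ici (2 * M)) {r h' : ℝ} (hr : 2 * M < r)
    (hh : HasDerivWithinAt S.height h' s r) :
    HasDerivWithinAt (S.flux φ₁) (-2 * r * φ (S.pt r) - 2 * r ^ 2 * S.dr φ (S.pt r)
      + h' * (r ^ 2 * D M r * S.dr φ (S.pt r))) s r := by
  have hp := S.pt_mem_exterior hr
  have hr0 : r ≠ 0 := by linarith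
  have hA := S.hasDerivWithinAt_comp_pt hs (S.differentiableWithinAt_future_of_exterior hp
    (((h₁.contDiffOn_dr hM).differentiableOn (by simp)) _ hp)) hh
  have hD := (((hasDerivAt_pow 2 r).mul (hasDerivAt_D (M := M) hr0)).hasDerivWithinAt
    (s := s)).mul hA
  refine hD.congr_deriv ?_
  rw [h₁.dv_dr hM hφ hp]
  have hw := h₁.wave_exterior hM hφ hp
  have e : (S.pt r).2 = r := rfl
  rw [e] at hw
  rw [← hw]
  simp only [Pi.mul_apply]
  field_simp
  ring

theorem IsTimeIntegral.continuousOn_flux (hM : 0 < M) (h₁ : S.IsTimeIntegral φ φ₁) :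
    ContinuousOn (S.flux φ₁) (Ioi (2 * M)) := by
  have h1 : ContinuousOn (fun r => S.dr φ₁ (S.pt r)) (Ioi (2 * M)) :=
    (h₁.contDiffOn_dr hM).continuousOn.comp ((S.continuousOn_pt hM).mono Ioi_subset_Ici_self)
      (fun r hr => S.pt_mem_exterior hr)
  have h2 : ContinuousOn (D M) (Ioi (2 * M)) :=
    (continuousOn_D M).mono (Ioi_subset_Ioi (by linarith))
  unfold flux
  fun_prop

theorem IsSmoothSolution.dr_rmul (hM : 0 < M) (hφ : S.IsSmoothSolution φ) {p : ℝ × ℝ}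
    (hp : p ∈ S.future) : S.dr (rmul φ) p = φ p + p.2 * S.dr φ p := by
  have h1 := (hasFDerivWithinAt_snd (𝕜 := ℝ) (s := S.future) (p := p)).mul
    (hφ.differentiableOn p hp).hasFDerivWithinAt
  rw [dr, show fderivWithin ℝ (rmul φ) S.future p = _ from
    h1.fderivWithin (S.uniqueDiffOn_future hM p hp)]
  simp [dr]
  ring

theorem IsSmoothSolution.dv_rmul (hM : 0 < M) (hφ : S.IsSmoothSolution φ) {p : ℝ × ℝ}
    (hp : p ∈ S.future) : S.dv (rmul φ) p = p.2 * S.dv φ p := by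
  have h1 := (hasFDerivWithinAt_snd (𝕜 := ℝ) (s := S.future) (p := p)).mul
    (hφ.differentiableOn p hp).hasFDerivWithinAt
  rw [dv, show fderivWithin ℝ (rmul φ) S.future p = _ from
    h1.fderivWithin (S.uniqueDiffOn_future hM p hp)]
  simp [dv]

theorem IsSmoothSolution.continuousOn_pt (hM : 0 < M) (hφ : S.IsSmoothSolution φ) :
    ContinuousOn (fun r => φ (S.pt r)) (Ici (2 * M)) :=
  hφ.smooth.continuousOn.comp (S.continuousOn_pt hM) fun _ hr => S.pt_mem_future hr

theorem IsSmoothSolution.continuousOn_dr_pt (hM : 0 < M) (hφ : S.IsSmoothSolution φ) :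
    ContinuousOn (fun r => S.dr φ (S.pt r)) (Ici (2 * M)) :=
  (hφ.continuousOn_fderivWithin hM (0, 1)).comp (S.continuousOn_pt hM)
    fun _ hr => S.pt_mem_future hr

theorem IsSmoothSolution.continuousOn_dv_pt (hM : 0 < M) (hφ : S.IsSmoothSolution φ) :
    ContinuousOn (fun r => S.dv φ (S.pt r)) (Ici (2 * M)) :=
  (hφ.continuousOn_fderivWithin hM (1, 0)).comp (S.continuousOn_pt hM)
    fun _ hr => S.pt_mem_future hr

/-- The flux through the sphere where `Σ₀` leaves the ingoing null part. -/
theorem IsTimeIntegral.flux_rH (hM : 0 < M) (hφ : S.IsSmoothSolution φ)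
    (h₁ : S.IsTimeIntegral φ φ₁) :
    S.flux φ₁ S.rH =
      2 * ∫ r in (2 * M)..S.rH, r * S.Lbar (rmul φ) (S.pt r) * (2 / D M r) := by
  have hlt := S.two_mul_lt_rH
  set g : ℝ → ℝ := fun r => -2 * r * φ (S.pt r) - 2 * r ^ 2 * S.dr φ (S.pt r) with hg
  have hderiv : ∀ r ∈ Ioo (2 * M) S.rH, HasDerivAt (S.flux φ₁) (g r) r := by
    intro r hr
    have h0 : HasDerivWithinAt S.height 0 (Ioo (2 * M) S.rH) r :=
      (hasDerivWithinAt_const r _ S.v₀).congr_of_mem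
        (fun x hx => S.height_eq_of_le_rH hx.1.le hx.2.le) hr
    have := h₁.hasDerivWithinAt_flux hM hφ (fun x hx => hx.1.le) hr.1 h0
    exact (this.hasDerivAt (Ioo_mem_nhds hr.1 hr.2)).congr_deriv (by simp [hg])
  have hgc : ContinuousOn g (Ici (2 * M)) := by
    exact ((by fun_prop : Continuous fun r : ℝ => -2 * r).continuousOn.mul
      (hφ.continuousOn_pt hM)).sub
      ((by fun_prop : Continuous fun r : ℝ => 2 * r ^ 2).continuousOn.mul
      (hφ.continuousOn_dr_pt hM))
  have hint : IntervalIntegrable g MeasureTheory.volume (2 * M) S.rH :=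
    (hgc.mono (by rw [uIcc_of_le hlt.le]; exact Icc_subset_Ici_self)).intervalIntegrable
  -- On the ingoing part `v = v₀` and the flux is `-2 r² L̲ φ₁`, so the horizon condition is
  -- precisely the vanishing of the flux there.
  have ha : Tendsto (S.flux φ₁) (𝓝[>] (2 * M)) (𝓝 0) := by
    have h2 : Tendsto (fun r : ℝ => -2 * r ^ 2) (𝓝[>] (2 * M)) (𝓝 (-2 * (2 * M) ^ 2)) :=
      ((by fun_prop : Continuous fun r : ℝ => -2 * r ^ 2).tendsto (2 * M)).mono_left
        nhdsWithin_le_nhds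
    have h3 := h2.mul h₁.lim_horizon
    rw [mul_zero] at h3
    refine h3.congr' ?_
    filter_upwards [Ioo_mem_nhdsGT hlt] with r hr
    have : S.pt r = (S.v₀, r) := by rw [pt, S.height_eq_of_le_rH hr.1.le hr.2.le]
    rw [flux, this, Lbar]
    ring
  have hb : Tendsto (S.flux φ₁) (𝓝[<] S.rH) (𝓝 (S.flux φ₁ S.rH)) :=
    (((h₁.continuousOn_flux hM).continuousAt (Ioi_mem_nhds hlt)).tendsto).mono_left
      nhdsWithin_le_nhds
  have key := intervalIntegral.integral_eq_sub_of_hasDerivAt_of_tendsto hlt hderiv hint ha hb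
  rw [sub_zero] at key
  rw [← key, ← intervalIntegral.integral_const_mul]
  refine intervalIntegral.integral_congr_ae (Eventually.of_forall fun r hr => ?_)
  rw [uIoc_of_le hlt.le] at hr
  have hD := D_pos hM hr.1
  rw [Lbar, hφ.dr_rmul hM (S.pt_mem_future hr.1.le)]
  simp only [hg, pt]
  field_simp
  ring

/-- The flux through the sphere where `Σ₀` becomes outgoing null. -/
theorem IsTimeIntegral.flux_R (hM : 0 < M) (hφ : S.IsSmoothSolution φ)
    (h₁ : S.IsTimeIntegral φ φ₁) :
    S.flux φ₁ R + 2 * R ^ 2 * φ (S.pt R) = S.C₀' φ := by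
  have hlt := S.rH_lt_R
  have h2M := S.two_mul_lt_rH
  obtain ⟨B, hB, hBd⟩ := S.exists_finite_hasDerivAt_height hM
  set g : ℝ → ℝ := fun r => r ^ 2 * (S.h r * S.dv φ (S.pt r)
    - (1 - D M r * S.h r) * S.dr φ (S.pt r)) with hg
  have cφ := (hφ.continuousOn_pt hM).mono (Ici_subset_Ici.2 h2M.le)
  have cr := (hφ.continuousOn_dr_pt hM).mono (Ici_subset_Ici.2 h2M.le)
  have cv := (hφ.continuousOn_dv_pt hM).mono (Ici_subset_Ici.2 h2M.le)
  have cD : ContinuousOn (D M) (Ici S.rH) :=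
    (continuousOn_D M).mono fun x hx => mem_Ioi.2 (by have := mem_Ici.1 hx; linarith)
  have hsub : uIcc S.rH R ⊆ Ici S.rH := by rw [uIcc_of_le hlt.le]; exact Icc_subset_Ici_self
  have hint : IntervalIntegrable g MeasureTheory.volume S.rH R := by
    have i1 : IntervalIntegrable (fun r => S.h r * (r ^ 2 * (S.dv φ (S.pt r)
        + D M r * S.dr φ (S.pt r)))) MeasureTheory.volume S.rH R :=
      S.h_smooth.intervalIntegrable.mul_continuousOn
        (ContinuousOn.mono (by fun_prop) hsub)
    have i2 : IntervalIntegrable (fun r => r ^ 2 * S.dr φ (S.pt r))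
        MeasureTheory.volume S.rH R :=
      ContinuousOn.intervalIntegrable (ContinuousOn.mono (by fun_prop) hsub)
    refine (i1.sub i2).congr fun r _ => ?_
    simp only [hg]
    ring
  -- Adding `r² φ` cancels the undifferentiated term `-2rφ` and turns what remains into the normal
  -- derivative weighted by the volume density.
  have hderiv : ∀ r ∈ Ioo S.rH R \ B,
      HasDerivAt (fun r => S.flux φ₁ r + r ^ 2 * φ (S.pt r)) (g r) r := by
    rintro r ⟨hr, hrB⟩
    have hr' : 2 * M < r := h2M.trans hr.1
    have hh := (hBd r hr' hrB).hasDerivWithinAt (s := Ici (2 * M))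
    have f1 := (h₁.hasDerivWithinAt_flux hM hφ subset_rfl hr' hh).hasDerivAt (Ici_mem_nhds hr')
    have f2 := (S.hasDerivWithinAt_comp_pt subset_rfl
      (hφ.differentiableOn _ (S.pt_mem_future hr'.le)) hh).hasDerivAt (Ici_mem_nhds hr')
    refine (f1.add ((hasDerivAt_pow 2 r).mul f2)).congr_deriv ?_
    simp only [hg]
    push_cast
    ring
  have hcont : ContinuousOn (fun r => S.flux φ₁ r + r ^ 2 * φ (S.pt r)) (Icc S.rH R) := by
    have c1 : ContinuousOn (S.flux φ₁) (Icc S.rH R) :=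
      (h₁.continuousOn_flux hM).mono fun r hr => h2M.trans_le hr.1
    have c2 := cφ.mono fun x (hx : x ∈ Icc S.rH R) => hx.1
    exact c1.add ((continuous_pow 2).continuousOn.mul c2)
  have key := MeasureTheory.integral_eq_of_hasDerivAt_off_countable_of_le _ g hlt.le hB.countable
    hcont hderiv hint
  -- The square roots in the normal and the density cancel where they are positive. They vanish at
  -- both endpoints, hence the passage to the open interval.
  have hN : (∫ r in S.rH..R, S.normal φ r * S.volDensity r) = ∫ r in S.rH..R, g r := by
    rw [intervalIntegral.integral_of_le hlt.le, intervalIntegral.integral_of_le hlt.le,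
      MeasureTheory.integral_Ioc_eq_integral_Ioo, MeasureTheory.integral_Ioc_eq_integral_Ioo]
    refine MeasureTheory.setIntegral_congr_fun measurableSet_Ioo fun r hr => ?_
    obtain ⟨h1, h2⟩ := S.h_spacelike r hr
    have hD := D_pos hM (h2M.trans hr.1)
    rw [lt_div_iff₀ hD] at h2
    have : 0 < √(S.h r * (2 - D M r * S.h r)) := by
      apply Real.sqrt_pos.2
      have : 0 < 2 - D M r * S.h r := by linarith
      positivity
    simp only [normal, volDensity, hg]
    field_simp
  rw [C₀', hN, key, ← h₁.flux_rH hM hφ]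
  ring

end TimeIntegral

/-! ### The outgoing null part and the limit of the flux -/

section Infinity

variable {M R : ℝ} {S : Slice M R} {φ φ₁ : ℝ × ℝ → ℝ}

theorem hasDerivWithinAt_comp_pt_Ici (hM : 0 < M) {f : ℝ × ℝ → ℝ} {r : ℝ} (hr : R ≤ r)
    (hf : DifferentiableWithinAt ℝ f S.future (S.pt r)) :
    HasDerivWithinAt (fun x => f (S.pt x))
      (S.dr f (S.pt r) + 2 / D M r * S.dv f (S.pt r)) (Ici R) r :=
  S.hasDerivWithinAt_comp_pt (Ici_subset_Ici.2 S.two_mul_lt_R.le) hf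
    (S.hasDerivWithinAt_height hM hr)

theorem drad_eq (hM : 0 < M) {f : ℝ × ℝ → ℝ} {r : ℝ} (hr : R ≤ r)
    (hf : DifferentiableWithinAt ℝ f S.future (S.pt r)) :
    S.drad f r =
      f (S.pt r) + r * (S.dr f (S.pt r) + 2 / D M r * S.dv f (S.pt r)) := by
  have h := (hasDerivWithinAt_id r (Ici R)).mul (hasDerivWithinAt_comp_pt_Ici hM hr hf)
  exact (h.derivWithin (uniqueDiffOn_Ici R r hr)).trans (by simp)

theorem IsSmoothSolution.drad_eq (hM : 0 < M) (hφ : S.IsSmoothSolution φ) {r : ℝ} (hr : R ≤ r) :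
    S.drad φ r =
      φ (S.pt r) + r * (S.dr φ (S.pt r) + 2 / D M r * S.dv φ (S.pt r)) :=
  Slice.drad_eq hM hr
    (hφ.differentiableOn _ (S.pt_mem_future (S.two_mul_lt_R.le.trans hr)))

theorem IsSmoothSolution.continuousOn_drad (hM : 0 < M) (hφ : S.IsSmoothSolution φ) :
    ContinuousOn (S.drad φ) (Ici R) := by
  have hs : Ici R ⊆ Ici (2 * M) := Ici_subset_Ici.2 S.two_mul_lt_R.le
  have h1 := (hφ.continuousOn_pt hM).mono hs
  have h2 := (hφ.continuousOn_dr_pt hM).mono hs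
  have h3 := (hφ.continuousOn_dv_pt hM).mono hs
  have h4 : ContinuousOn (fun r => 2 / D M r) (Ici R) := fun r hr =>
    (continuousAt_two_div_D hM (S.two_mul_lt_R.trans_le hr)).continuousWithinAt
  exact (h1.add (continuousOn_id.mul (h2.add (h4.mul h3)))).congr fun r hr => hφ.drad_eq hM hr

/-- The quantity `D r² ∂_r φ₁` along the outgoing null part of `Σ₀`, with `∂_r` tangent to it. -/
noncomputable def nullFlux (S : Slice M R) (φ φ₁ : ℝ × ℝ → ℝ) (r : ℝ) : ℝ :=
  S.flux φ₁ r + 2 * r ^ 2 * φ (S.pt r)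

/-- With `h' = 2/D` the source of the flux equation loses its `∂_r φ` term and becomes `-2rφ`; the
derivative of `2r² φ` completes it to `2r ∂_r(rφ)`. -/
theorem IsTimeIntegral.hasDerivWithinAt_nullFlux (hM : 0 < M) (hφ : S.IsSmoothSolution φ)
    (h₁ : S.IsTimeIntegral φ φ₁) {r : ℝ} (hr : R ≤ r) :
    HasDerivWithinAt (S.nullFlux φ φ₁) (2 * r * S.drad φ r) (Ici R) r := by
  have hr' := S.two_mul_lt_R.trans_le hr
  have h1 := h₁.hasDerivWithinAt_flux hM hφ (Ici_subset_Ici.2 S.two_mul_lt_R.le) hr'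
    (S.hasDerivWithinAt_height hM hr)
  have h2 := hasDerivWithinAt_comp_pt_Ici hM hr
    (hφ.differentiableOn _ (S.pt_mem_future hr'.le))
  have h3 := ((hasDerivAt_pow 2 r).const_mul 2).hasDerivWithinAt (s := Ici R)
  refine (h1.add (h3.mul h2)).congr_deriv ?_
  rw [hφ.drad_eq hM hr]
  have := (D_pos hM hr').ne'
  field_simp
  push_cast
  ring

/-- The tangential derivative is `∂_r + (2/D) ∂_v`, and `∂_v φ₁ = φ`; multiplying by `D r²` gives
the null flux. -/
theorem IsTimeIntegral.hasDerivWithinAt_pt (hM : 0 < M)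
    (h₁ : S.IsTimeIntegral φ φ₁) {r : ℝ} (hr : R ≤ r) :
    HasDerivWithinAt (fun x => φ₁ (S.pt x)) ((D M r)⁻¹ * S.nullFlux φ φ₁ r / r ^ 2) (Ici R) r := by
  have hr' := S.two_mul_lt_R.trans_le hr
  have hp := S.pt_mem_exterior hr'
  refine (hasDerivWithinAt_comp_pt_Ici hM hr (S.differentiableWithinAt_future_of_exterior hp
    (h₁.regular.differentiableOn (by simp) _ hp))).congr_deriv ?_
  rw [h₁.time_deriv _ hp.1 hr', nullFlux, flux]
  have := (D_pos hM hr').ne'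
  have : r ≠ 0 := by linarith
  field_simp

theorem IsTimeIntegral.drad_eq (hM : 0 < M) (h₁ : S.IsTimeIntegral φ φ₁) {r : ℝ} (hr : R ≤ r) :
    S.drad φ₁ r = φ₁ (S.pt r) + r * ((D M r)⁻¹ * S.nullFlux φ φ₁ r / r ^ 2) := by
  have h := (hasDerivWithinAt_id r (Ici R)).mul (h₁.hasDerivWithinAt_pt hM hr)
  exact (h.derivWithin (uniqueDiffOn_Ici R r hr)).trans (by simp)

theorem IsTimeIntegral.drad2_eq (hM : 0 < M) (hφ : S.IsSmoothSolution φ)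
    (h₁ : S.IsTimeIntegral φ φ₁) {r : ℝ} (hr : R ≤ r) :
    S.drad2 φ₁ r = 2 * (D M r)⁻¹ * S.drad φ r
      - 2 * M * (D M r)⁻¹ ^ 2 * S.nullFlux φ φ₁ r / r ^ 3 := by
  have hlt : ∀ x, R ≤ x → 0 < x - 2 * M := fun x hx => sub_pos.2 (S.two_mul_lt_R.trans_le hx)
  have hinv : ∀ x, R ≤ x → (D M x)⁻¹ = x / (x - 2 * M) := fun x hx => by
    have h1 := hlt x hx
    have hx0 : x ≠ 0 := by linarith
    rw [← D_mul_self (M := M) hx0]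
    have := (D_pos hM (S.two_mul_lt_R.trans_le hx)).ne'
    field_simp
  have hr0 : r ≠ 0 := by have := hlt r hr; linarith
  have hd := ((h₁.hasDerivWithinAt_nullFlux hM hφ hr).div
    ((hasDerivWithinAt_id r (Ici R)).sub_const (2 * M)) (hlt r hr).ne')
  have h := (h₁.hasDerivWithinAt_pt hM hr).add hd
  -- Since `D r = r - 2M`, the first derivative of `rφ₁` is `φ₁ + nullFlux / (r - 2M)`, whose terms
  -- both have known derivatives.
  have h' : HasDerivWithinAt (S.drad φ₁) _ (Ici R) r := h.congr_of_mem (fun x hx => by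
    have hx0 : x ≠ 0 := by have := hlt x hx; linarith
    have := (hlt x hx).ne'
    rw [h₁.drad_eq hM hx, hinv x hx]
    simp only [Pi.add_apply, Pi.div_apply, id]
    field_simp) hr
  rw [drad2, h'.derivWithin (uniqueDiffOn_Ici R r hr), hinv r hr]
  have := (hlt r hr).ne'
  simp only [id]
  field_simp
  ring

theorem IsSmoothSolution.integrableOn_mul_drad (hM : 0 < M) (hφ : S.IsSmoothSolution φ)
    {β Λ I J P : ℝ} (hβ0 : 0 < β) (hP : 0 ≤ P)
    (hΛ : ∀ r, R ≤ r → |Real.log r| + 1 ≤ Λ * r ^ (1 - β))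
    (hq : ∀ r, R ≤ r →
      |S.drad φ r - I * (Real.log r / r ^ 3) - J / r ^ 3| ≤ P * r ^ (-3 - β)) :
    MeasureTheory.IntegrableOn (fun r => r * S.drad φ r) (Ioi R) := by
  have hR : 0 < R := by have := S.two_mul_lt_R; linarith
  -- The expansion bounds `r ∂_r(rφ)` by `r⁻² (1 + |log r|)` and `r^(-2-β)`. The logarithmic bound
  -- accounts for `Λ`, and `r ≥ R` for the factor `1/R`.
  have hdom := (integrableOn_Ioi_rpow_of_lt (a := -1 - β) (by linarith) hR).const_mul
    ((|I| + |J|) * Λ + P / R)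
  refine MeasureTheory.Integrable.mono' hdom ?_ ?_
  · exact ((continuousOn_id.mul (hφ.continuousOn_drad hM)).mono
      Ioi_subset_Ici_self).aestronglyMeasurable measurableSet_Ioi
  · refine (MeasureTheory.ae_restrict_mem measurableSet_Ioi).mono fun r hr => ?_
    have hr : R ≤ r := le_of_lt hr
    have hr0 := hR.trans_le hr
    set Y := r ^ (-3 - β) with hY
    have hY0 : 0 < Y := Real.rpow_pos_of_pos hr0 _
    have hX : r ^ (-1 - β) = r ^ 2 * Y := by
      rw [hY, ← Real.rpow_natCast r 2, ← Real.rpow_add hr0]; congr 1; push_cast; ring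
    have hl : |Real.log r| + 1 ≤ Λ * (r ^ 4 * Y) := by
      refine (hΛ r hr).trans_eq ?_
      rw [hY, ← Real.rpow_natCast r 4, ← Real.rpow_add hr0]; congr 2; push_cast; ring
    rw [Real.norm_eq_abs, abs_mul, abs_of_pos hr0, hX]
    have e1 : |S.drad φ r| ≤ P * Y + (|I| * |Real.log r| + |J|) / r ^ 3 := by
      have t1 := abs_add_le (S.drad φ r - I * (Real.log r / r ^ 3) - J / r ^ 3)
        ((I * Real.log r + J) / r ^ 3)
      have t2 : |(I * Real.log r + J) / r ^ 3| ≤ (|I| * |Real.log r| + |J|) / r ^ 3 := by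
        rw [abs_div, abs_of_pos (by positivity : 0 < r ^ 3), ← abs_mul]
        gcongr
        exact abs_add_le _ _
      rw [show S.drad φ r - I * (Real.log r / r ^ 3) - J / r ^ 3
        + (I * Real.log r + J) / r ^ 3 = S.drad φ r by ring] at t1
      linarith [hq r hr]
    have e2 : |I| * |Real.log r| + |J| ≤ (|I| + |J|) * (Λ * (r ^ 4 * Y)) := by
      have := abs_nonneg (Real.log r)
      calc |I| * |Real.log r| + |J| ≤ (|I| + |J|) * (|Real.log r| + 1) := by
            nlinarith [abs_nonneg I, abs_nonneg J, mul_nonneg (abs_nonneg J) this]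
        _ ≤ _ := by gcongr
    calc r * |S.drad φ r| ≤ r * (P * Y + (|I| + |J|) * (Λ * (r ^ 4 * Y)) / r ^ 3) := by
          gcongr; exact e1.trans (by gcongr)
      _ = (|I| + |J|) * Λ * (r ^ 2 * Y) + P / R * (R * r * Y) := by field_simp; ring
      _ ≤ (|I| + |J|) * Λ * (r ^ 2 * Y) + P / R * (r * r * Y) := by gcongr
      _ = _ := by ring

/-- On the null part `L` multiplied by `2/D` is the tangential derivative. The last integral in `C₀`
is thus the total increase of the null flux beyond `R`, and integrability identifies it with the
limit of the increments over finite intervals. -/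
theorem IsTimeIntegral.tendsto_nullFlux (hM : 0 < M) (hφ : S.IsSmoothSolution φ)
    (h₁ : S.IsTimeIntegral φ φ₁)
    (hint : MeasureTheory.IntegrableOn (fun r => r * S.drad φ r) (Ioi R)) :
    Tendsto (S.nullFlux φ φ₁) atTop (𝓝 (S.C₀ φ)) := by
  have hC : S.C₀ φ = S.nullFlux φ φ₁ R + ∫ r in Ioi R, 2 * (r * S.drad φ r) := by
    rw [C₀, nullFlux, h₁.flux_R hM hφ, MeasureTheory.integral_const_mul]
    congr 2
    refine MeasureTheory.setIntegral_congr_fun measurableSet_Ioi fun r hr => ?_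
    have hr' := S.two_mul_lt_R.trans hr
    have hf := S.pt_mem_future hr'.le
    have := (D_pos hM hr').ne'
    rw [L, hφ.dr_rmul hM hf, hφ.dv_rmul hM hf, hφ.drad_eq hM (le_of_lt hr)]
    simp only [pt]
    field_simp
    ring
  rw [hC]
  have hlim := (MeasureTheory.intervalIntegral_tendsto_integral_Ioi R (hint.const_mul 2)
    tendsto_id).const_add (S.nullFlux φ φ₁ R)
  refine hlim.congr' ?_
  filter_upwards [eventually_ge_atTop R] with r hr
  have hd := fun x (hx : R ≤ x) => h₁.hasDerivWithinAt_nullFlux hM hφ hx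
  have key := intervalIntegral.integral_eq_sub_of_hasDerivAt_of_le hr
    (f := S.nullFlux φ φ₁) (f' := fun r => 2 * (r * S.drad φ r))
    (fun x hx => ((hd x hx.1).continuousWithinAt).mono Icc_subset_Ici_self)
    (fun x hx => ((hd x hx.1.le).hasDerivAt (Ici_mem_nhds hx.1)).congr_deriv (by ring))
    (((continuousOn_id.mul (hφ.continuousOn_drad hM)).const_mul 2 |>.mono
      (by rw [uIcc_of_le hr]; exact Icc_subset_Ici_self)).intervalIntegrable)
  simp only [id]
  rw [key]
  ring

end Infinity

/-- Multiplying the expansion by `r²` leaves an error `K r^(-β)`. All three modified Newman–Penrose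
constants are read off from this single limit. -/
theorem tendsto_of_expansion {g : ℝ → ℝ} {R β I A K : ℝ} (hR : 0 < R) (hβ0 : 0 < β)
    (hg : ∀ r, R ≤ r → |g r + I * (Real.log r / r ^ 2) + A / r ^ 2| ≤ K * r ^ (-2 - β)) :
    Tendsto (fun r => r ^ 2 * g r + I * Real.log r) atTop (𝓝 (-A)) := by
  rw [tendsto_iff_norm_sub_tendsto_zero]
  have hz : Tendsto (fun r : ℝ => K * r ^ (-β)) atTop (𝓝 0) := by
    simpa using (tendsto_rpow_neg_atTop hβ0).const_mul K
  refine squeeze_zero' (Eventually.of_forall fun _ => norm_nonneg _) ?_ hz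
  filter_upwards [eventually_ge_atTop R] with r hr
  have hr0 := hR.trans_le hr
  have e : r ^ 2 * g r + I * Real.log r - -A =
      r ^ 2 * (g r + I * (Real.log r / r ^ 2) + A / r ^ 2) := by field_simp; ring
  rw [e, Real.norm_eq_abs, abs_mul, abs_of_pos (by positivity : 0 < r ^ 2)]
  refine (mul_le_mul_of_nonneg_left (hg r hr) (by positivity)).trans_eq ?_
  rw [mul_left_comm, ← Real.rpow_natCast r 2, ← Real.rpow_add hr0]
  congr 2; push_cast; ring

end Slice
end Schwarzschild

theorem proposition5p3 (R β : ℝ) (hR : 0 < R) (hβ0 : 0 < β) (hβ1 : β < 1) :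
    ∃ C : ℝ, 0 < C ∧ ∀ M : ℝ, 0 < M → ∀ (S : Schwarzschild.Slice M R) (φ φ₁ : ℝ × ℝ → ℝ)
      (I J P : ℝ),
      S.IsSmoothSolution φ →
      S.IsNPConstant (fun r => r ^ 3 / Real.log r) φ I →
      (∀ r, R ≤ r →
        |S.drad φ r - I * (Real.log r / r ^ 3) - J / r ^ 3| ≤ P * r ^ (-3 - β)) →
      S.IsTimeIntegral φ φ₁ →
      (∀ r, R ≤ r →
        |S.drad φ₁ r + I * (Real.log r / r ^ 2) + (J + 1 / 2 * I - M * S.C₀ φ) / r ^ 2| ≤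
          C * (P + |I| + |J| + |S.C₀ φ|) * r ^ (-2 - β)) ∧
      (∀ r, R ≤ r →
        |S.drad2 φ₁ r - 2 * I * (Real.log r / r ^ 3) - (2 * J - 2 * M * S.C₀ φ) / r ^ 3| ≤
          C * (P + |I| + |J| + |S.C₀ φ|) * r ^ (-3 - β)) ∧
      ∃ Ilog I' I'' : ℝ,
        S.IsNPConstant (fun r => r ^ 2 / Real.log r) φ₁ Ilog ∧
        S.IsPrimedConstant φ₁ Ilog (Real.log 2) I' ∧
        S.IsPrimedConstant φ₁ Ilog (-Real.log 2) I'' ∧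
        Ilog = -I ∧
        I' + Real.log 2 * Ilog = M * S.C₀ φ - J - 1 / 2 * I ∧
        I'' - Real.log 2 * Ilog = M * S.C₀ φ - J - 1 / 2 * I := by
  obtain ⟨Λ, hΛ0, hΛ⟩ := Schwarzschild.exists_log_bound hR hβ1
  -- This is the constant of the second-derivative bound; it dominates that of the first, `2R²Λ +
  -- 4RΛ + 8`.
  refine ⟨2 * R ^ 2 * Λ + 6 * R * Λ + 8, by positivity, ?_⟩
  intro M hM S φ φ₁ I J P hφ _ hq h₁
  -- Evaluating the assumed bound at `r = R` forces `P` to be nonnegative.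
  have hP : 0 ≤ P := nonneg_of_mul_nonneg_left ((abs_nonneg _).trans (hq R le_rfl))
    (Real.rpow_pos_of_pos hR _)
  have hlim := h₁.tendsto_nullFlux hM hφ (hφ.integrableOn_mul_drad hM hβ0 hP hΛ hq)
  have hE := Schwarzschild.flux_remainder hR hβ0 hP hq
    (fun r hr => h₁.hasDerivWithinAt_nullFlux hM hφ hr) hlim
  have main : ∀ r, R ≤ r →
      |S.drad φ₁ r + I * (Real.log r / r ^ 2) + (J + 1 / 2 * I - M * S.C₀ φ) / r ^ 2| ≤
        (2 * R ^ 2 * Λ + 6 * R * Λ + 8) * (P + |I| + |J| + |S.C₀ φ|) * r ^ (-2 - β) := by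
    intro r hr
    have hr0 := hR.trans_le hr
    rw [h₁.drad_eq hM hr]
    refine (Schwarzschild.first_derivative_expansion hM S.lt_R hβ0 hP hΛ hE
      (fun r hr => h₁.hasDerivWithinAt_pt hM hr) h₁.lim_infinity hr).trans ?_
    gcongr ?_ * _ * _
    nlinarith [mul_pos hR hΛ0]
  refine ⟨main, fun r hr => ?_, ?_⟩
  · rw [h₁.drad2_eq hM hφ hr]
    exact Schwarzschild.second_derivative_expansion hM S.lt_R hP hΛ hq hE hr
  · have ht := Schwarzschild.Slice.tendsto_of_expansion hR hβ0 main
    have hlog : ∀ᶠ r : ℝ in atTop, 1 < r := eventually_gt_atTop 1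
    -- Replacing `log r` by `log r ± log 2` in the subtracted term, whose coefficient is `-I`,
    -- shifts the limit by `± I log 2`.
    refine ⟨-I, -(J + 1 / 2 * I - M * S.C₀ φ) + I * Real.log 2,
      -(J + 1 / 2 * I - M * S.C₀ φ) - I * Real.log 2, ?_, ?_, ?_, rfl, by ring, by ring⟩
    · have h0 := (ht.div_atTop Real.tendsto_log_atTop).sub_const I
      rw [zero_sub] at h0
      refine h0.congr' ?_
      filter_upwards [hlog] with r hr
      have := (Real.log_pos hr).ne'
      field_simp
      ring
    · refine (ht.add_const (I * Real.log 2)).congr' ?_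
      filter_upwards [hlog] with r hr
      field_simp
      ring
    · refine (ht.sub_const (I * Real.log 2)).congr' ?_
      filter_upwards [hlog] with r hr
      field_simp
      ring
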